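/- Let $U\subseteq\mathbb R^4$ be a coordinate domain of a space-time with smooth Lorentzian metric $g$ and Levi-Civita connection $\nabla$, and let $(e_1,e_2,e_3,e_4)=(m,\overline m,\ell,k)$ be a smooth Newman–Penrose null tetrad on $U$ ($k,\ell$ real, $m\cdot\overline m=1$, $k\cdot\ell=-1$, all other products zero). Put $\Gamma_{abc}=e_a\cdot\nabla_{e_c}e_b$, $D=k^a\partial_a$, $\Delta=\ell^a\partial_a$, $\delta=m^a\partial_a$, and $\kappa=-\Gamma_{144}=-k_{a;b}m^ak^b$, $\rho=-\Gamma_{142}$, $\sigma=-\Gamma_{141}$, $\tau=-\Gamma_{143}$, $\nu=\Gamma_{233}$, $\mu=\Gamma_{231}$, $\lambda=\Gamma_{232}$, $\pi=\Gamma_{234}$, $\varepsilon=-\tfrac12(\Gamma_{344}-\Gamma_{214})$, $\beta=-\tfrac12(\Gamma_{341}-\Gamma_{211})$, $\gamma=\tfrac12(\Gamma_{433}-\Gamma_{123})$, $\alpha=\tfrac12(\Gamma_{432}-\Gamma_{122})$. Let $R_{abcd}$ be the tetrad components of a smooth real tensor field with the algebraic symmetries of a Riemann tensor (an independent variable, not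 assumed to be the curvature of $g$), with $R_{bd}=R^c{}_{bcd}$, $R=R^b{}_b$, Weyl part $C_{abcd}$, and $\Psi_0=C_{4141}$, $\Psi_1=C_{4341}$, $\Psi_2=C_{4123}$, $\Psi_3=C_{4323}$, $\Psi_4=C_{2323}$, $\Phi_{00}=\tfrac12R_{44}$, $\Phi_{01}=\overline{\Phi_{10}}=\tfrac12R_{41}$, $\Phi_{02}=\overline{\Phi_{20}}=\tfrac12R_{11}$, $\Phi_{11}=\tfrac14(R_{43}+R_{12})$, $\Phi_{12}=\overline{\Phi_{21}}=\tfrac12R_{31}$, $\Phi_{22}=\tfrac12R_{33}$. The Newman–Penrose equations $NP_1,\dots,NP_{18}$ are the equations 1. $D\rho-\overline\delta\kappa=\rho^2+\sigma\overline\sigma+(\varepsilon+\overline\varepsilon)\rho-\overline\kappa\tau-\kappa(3\alpha+\overline\beta-\pi)+\Phi_{00}$ 2. $D\sigma-\delta\kappa=(\rho+\overline\rho)\sigma+(3\varepsilon-\overline\varepsilon)\sigma-(\tau-\overline\pi+\overline\alpha+3\beta)\kappa+\Psi_0$ 3. $D\tau-\Delta\kappa=(\tau+\overline\pi)\rho+(\overline\tau+\pi)\sigma+(\varepsilon-\overline\varepsilon)\tau-(3\gamma+\overline\gamma)\kappa+\Psi_1+\Phi_{01}$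 4. $D\alpha-\overline\delta\varepsilon=(\rho+\overline\varepsilon-2\varepsilon)\alpha+\beta\overline\sigma-\overline\beta\varepsilon-\kappa\lambda-\overline\kappa\gamma+(\varepsilon+\rho)\pi+\Phi_{10}$ 5. $D\beta-\delta\varepsilon=(\alpha+\pi)\sigma+(\overline\rho-\overline\varepsilon)\beta-(\mu+\gamma)\kappa-(\overline\alpha-\overline\pi)\varepsilon+\Psi_1$ 6. $D\gamma-\Delta\varepsilon=(\tau+\overline\pi)\alpha+(\overline\tau+\pi)\beta-(\varepsilon+\overline\varepsilon)\gamma-(\gamma+\overline\gamma)\varepsilon+\tau\pi-\nu\kappa+\Psi_2+\Phi_{11}-R/24$ 7. $D\lambda-\overline\delta\pi=\rho\lambda+\overline\sigma\mu+\pi^2+(\alpha-\overline\beta)\pi-\nu\overline\kappa-(3\varepsilon-\overline\varepsilon)\lambda+\Phi_{20}$ 8. $D\mu-\delta\pi=\overline\rho\mu+\sigma\lambda+\pi\overline\pi-(\varepsilon+\overline\varepsilon)\mu-\pi(\overline\alpha-\beta)-\kappa\nu+\Psi_2+R/12$ 9. $D\nu-\Delta\pi=(\pi+\overline\tau)\mu+(\overline\pi+\tau)\lambda+(\gamma-\overline\gamma)\pi-(3\varepsilon+\overline\varepsilon)\nu+\Psi_3+\Phi_{21}$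 10. $\Delta\lambda-\overline\delta\nu=-(\mu+\overline\mu)\lambda-(3\gamma-\overline\gamma)\lambda+(3\alpha+\overline\beta+\pi-\overline\tau)\nu-\Psi_4$ 11. $\delta\rho-\overline\delta\sigma=\rho(\overline\alpha+\beta)-\sigma(3\alpha-\overline\beta)+(\rho-\overline\rho)\tau+(\mu-\overline\mu)\kappa-\Psi_1+\Phi_{01}$ 12. $\delta\alpha-\overline\delta\beta=\mu\rho-\lambda\sigma+\alpha\overline\alpha+\beta\overline\beta-2\alpha\beta+\gamma(\rho-\overline\rho)+\varepsilon(\mu-\overline\mu)-\Psi_2+\Phi_{11}+R/24$ 13. $\delta\lambda-\overline\delta\mu=(\rho-\overline\rho)\nu+(\mu-\overline\mu)\pi+\mu(\alpha+\overline\beta)+\lambda(\overline\alpha-3\beta)-\Psi_3+\Phi_{21}$ 14. $\delta\nu-\Delta\mu=\mu^2+\lambda\overline\lambda+(\gamma+\overline\gamma)\mu-\overline\nu\pi+(\tau-3\beta-\overline\alpha)\nu+\Phi_{22}$ 15. $\delta\gamma-\Delta\beta=(\tau-\overline\alpha-\beta)\gamma+\mu\tau-\sigma\nu-\varepsilon\overline\nu-\beta(\gamma-\overline\gamma-\mu)+\alpha\overline\lambda+\Phi_{12}$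 16. $\delta\tau-\Delta\sigma=\mu\sigma+\overline\lambda\rho+(\tau+\beta-\overline\alpha)\tau-(3\gamma-\overline\gamma)\sigma-\kappa\overline\nu+\Phi_{02}$ 17. $\Delta\rho-\overline\delta\tau=-(\rho\overline\mu+\sigma\lambda)+(\overline\beta-\alpha-\overline\tau)\tau+(\gamma+\overline\gamma)\rho+\nu\kappa-\Psi_2-R/12$ 18. $\Delta\alpha-\overline\delta\gamma=(\rho+\varepsilon)\nu-(\tau+\beta)\lambda+(\overline\gamma-\overline\mu)\alpha+(\overline\beta-\overline\tau)\gamma-\Psi_3$ and $NP_n$ also denotes left-hand side minus right-hand side. The field equations are (F) $NP_{10}$, $NP_{13}$, $NP_{12}+\overline{NP_{12}}$, $NP_{14}+\overline{NP_{14}}$; the remaining Newman–Penrose equations are (J) $\overline{NP_1}-NP_1$, $\overline{NP_{14}}-NP_{14}$, $\overline{NP_{12}}+\overline{NP_8}-NP_{12}-NP_8$, $\overline{NP_6}-NP_6+NP_8-\overline{NP_8}$, $NP_{16}-\overline{NP_7}$, $NP_{17}+NP_8$, $2NP_4-\overline{NP_3}-\overline{NP_{11}}$, $2NP_5-NP_3+NP_{11}$,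 $2NP_{15}-\overline{NP_9}-\overline{NP_{13}}$, $2NP_{18}+NP_9-NP_{13}$, and (R) $NP_1$, $NP_2$, $NP_3$, $NP_{11}$, $NP_{16}$, $NP_{17}$, $\overline{NP_4}+NP_5$, $NP_{15}-\overline{NP_{18}}$, $\overline{NP_6}+NP_6$, $\overline{NP_{12}}-NP_{12}$, each expression being equated to zero. The Bianchi equations are $R_{ab[cd;e]}=0$. **Theorem.** (i) For arbitrary smooth tetrad $(m,\overline m,\ell,k)$, $\Gamma_{abc}$ (with $\Gamma_{(ab)c}=0$ and the reality property) and $R_{abcd}$, regarded as independent variables, with $\gamma^c{}_{ab}=\Gamma^c{}_{ba}-\Gamma^c{}_{ab}$: at each point $NP_1,\dots,NP_{18}$ together are equivalent to the second Cartan equations; (J) is equivalent to the Jacobi equations $e_{[a}\gamma^d{}_{bc]}-\gamma^d{}_{e[a}\gamma^e{}_{bc]}=0$; (R) is equivalent to the Ricci equations $k^a{}_{;c;d}-k^a{}_{;d;c}=R^a{}_{bdc}k^b$ for $k$; and $NP_1,\dots,NP_{18}$ together are equivalent to (J), (R) and (F) together. (ii) If $\kappa\neq0$ on $U$, then (F)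 are integrability conditions of the remaining Newman–Penrose equations together with the Bianchi equations: whenever $g$, the null tetrad and $R_{abcd}$ satisfy (J), (R) and the Bianchi equations on $U$, they satisfy (F) on $U$. (iii) The equations (F) are not algebraic consequences of those equations: at a point where the variables of (i), with linearly independent tetrad, satisfy the commutator relations $[e_a,e_b]=\gamma^c{}_{ab}e_c$, (J), (R), the Bianchi equations and $\kappa\ne0$, the expressions in (F) can take arbitrary values in $\mathbb C\times\mathbb C\times\mathbb R\times\mathbb R$. -/

import Mathlib

open scoped ContDiff

noncomputable section

namespace NewmanPenrose

/-! ### Calculus on a coordinate domain -/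

/-- Points of a coordinate domain of space-time. -/
abbrev Coord := Fin 4 → ℝ

/-- Complex scalar fields. -/
abbrev Scalar := Coord → ℂ

/-- Complex vector fields, given by their coordinate components. -/
abbrev VecField := Coord → Fin 4 → ℂ

/-- The directional derivative `v(f) = v ^ i ∂ᵢ f` along a complex vector field. -/
def dirDeriv (v : VecField) (f : Scalar) : Scalar :=
  fun x => ∑ i, v x i * fderiv ℝ f x (Pi.single i 1)

/-! ### Metric and Levi-Civita connection in coordinates -/

/-- The Christoffel symbols
`Γ^i_{jk} = (1/2) g^{il} (∂_j g_{lk} + ∂_k g_{lj} - ∂_l g_{jk})`. -/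
def christoffel (g : Coord → Matrix (Fin 4) (Fin 4) ℝ) (i j k : Fin 4) (x : Coord) : ℝ :=
  (1 / 2) * ∑ l, (g x)⁻¹ i l *
    (fderiv ℝ (fun y => g y l k) x (Pi.single j 1)
      + fderiv ℝ (fun y => g y l j) x (Pi.single k 1)
      - fderiv ℝ (fun y => g y j k) x (Pi.single l 1))

/-- The covariant derivative `∇_V W` of the Levi-Civita connection of `g`. -/
def covDeriv (g : Coord → Matrix (Fin 4) (Fin 4) ℝ) (V W : VecField) : VecField :=
  fun x i => dirDeriv V (fun y => W y i) x
    + ∑ j, ∑ k, (christoffel g i j k x : ℂ) * V x j * W x k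

/-- The complex-bilinear extension of the metric. -/
def metricInner (g : Coord → Matrix (Fin 4) (Fin 4) ℝ) (V W : VecField) : Scalar :=
  fun x => ∑ i, ∑ j, (g x i j : ℂ) * V x i * W x j

/-! ### Null tetrads -/

/-- The constant tetrad metric `g_{ab} = e_a · e_b` of a null tetrad `(m, m̄, ℓ, k)`:
`m · m̄ = 1`, `ℓ · k = -1`, all other products zero. This matrix is its own inverse. -/
def eta : Matrix (Fin 4) (Fin 4) ℂ :=
  !![0, 1, 0, 0; 1, 0, 0, 0; 0, 0, 0, -1; 0, 0, -1, 0]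

/-- Complex conjugation exchanges the tetrad vectors `m` and `m̄`, and fixes `ℓ` and `k`. -/
def conjIdx : Fin 4 → Fin 4 := ![1, 0, 2, 3]

/-- The data of a tetrad: a complex vector field `m` and real vector fields `ℓ`, `k`. -/
structure Tetrad where
  m : VecField
  l : Coord → Fin 4 → ℝ
  k : Coord → Fin 4 → ℝ

/-- The tetrad vectors `e_1, …, e_4 = m, m̄, ℓ, k` (numbered from `0` to `3` here). -/
def Tetrad.e (t : Tetrad) : Fin 4 → VecField :=
  ![t.m, fun x i => star (t.m x i), fun x i => (t.l x i : ℂ), fun x i => (t.k x i : ℂ)]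

/-- The vector fields of the tetrad are smooth on `U`. -/
def Tetrad.SmoothOn (t : Tetrad) (U : Set Coord) : Prop :=
  ContDiffOn ℝ ∞ t.m U ∧ ContDiffOn ℝ ∞ t.l U ∧ ContDiffOn ℝ ∞ t.k U

/-- `t` is a smooth null tetrad on `U` for the smooth metric `g`. The last condition forces `g` to
be nondegenerate of Lorentzian signature `(-+++)` and the tetrad to be a basis at each point. -/
structure IsNullTetradOn (U : Set Coord) (g : Coord → Matrix (Fin 4) (Fin 4) ℝ) (t : Tetrad) :
    Prop where
  metric_smooth : ∀ i j, ContDiffOn ℝ ∞ (fun x => g x i j) U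
  metric_symm : ∀ x ∈ U, (g x).IsSymm
  tetrad_smooth : t.SmoothOn U
  inner_eq : ∀ x ∈ U, ∀ a b, metricInner g (t.e a) (t.e b) x = eta a b

/-- Tetrad components `R_{abcd}` of a field of (real) algebraic curvature tensors, smooth
on `U`. -/
structure IsCurvatureFieldOn (U : Set Coord) (Rm : Fin 4 → Fin 4 → Fin 4 → Fin 4 → Scalar) :
    Prop where
  smooth : ∀ a b c d, ContDiffOn ℝ ∞ (Rm a b c d) U
  antisymm_left : ∀ x ∈ U, ∀ a b c d, Rm a b c d x = -Rm b a c d x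
  antisymm_right : ∀ x ∈ U, ∀ a b c d, Rm a b c d x = -Rm a b d c x
  pair_symm : ∀ x ∈ U, ∀ a b c d, Rm a b c d x = Rm c d a b x
  cyclic : ∀ x ∈ U, ∀ a b c d, Rm a b c d x + Rm a c d b x + Rm a d b c x = 0
  real : ∀ x ∈ U, ∀ a b c d,
    star (Rm a b c d x) = Rm (conjIdx a) (conjIdx b) (conjIdx c) (conjIdx d) x

/-! ### The variables of the extended tetrad formalism -/

/-- The variables of the formalism: a tetrad, connection coefficients `Γ_{abc}` (last index:
direction of differentiation) and the tetrad components `R_{abcd}` of the Riemann tensor, which is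
an independent variable (equivalent to the Weyl scalars `Ψ`, the Ricci scalars `Φ` and `R`). -/
structure Fields where
  t : Tetrad
  Γ : Fin 4 → Fin 4 → Fin 4 → Scalar
  Rm : Fin 4 → Fin 4 → Fin 4 → Fin 4 → Scalar

/-- The fields belonging to a null tetrad of a metric `g` and a candidate Riemann tensor `Rm`:
`Γ_{abc} = e_a · ∇_{e_c} e_b` with the Levi-Civita connection `∇` of `g`. -/
def Fields.ofMetric (g : Coord → Matrix (Fin 4) (Fin 4) ℝ) (t : Tetrad)
    (Rm : Fin 4 → Fin 4 → Fin 4 → Fin 4 → Scalar) : Fields where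
  t := t
  Γ := fun a b c => metricInner g (t.e a) (covDeriv g (t.e c) (t.e b))
  Rm := Rm

namespace Fields

variable (F : Fields)

/-- The variables are smooth on `U`, the connection coefficients are those of a real connection for
which the tetrad metric is constant (`Γ_{(ab)c} = 0`), and `Rm` has the algebraic
symmetries of a Riemann tensor. -/
structure IsAdmissibleOn (U : Set Coord) : Prop where
  tetrad_smooth : F.t.SmoothOn U
  conn_smooth : ∀ a b c, ContDiffOn ℝ ∞ (F.Γ a b c) U
  conn_antisymm : ∀ x ∈ U, ∀ a b c, F.Γ a b c x = -F.Γ b a c x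
  conn_real : ∀ x ∈ U, ∀ a b c,
    star (F.Γ a b c x) = F.Γ (conjIdx a) (conjIdx b) (conjIdx c) x
  curv : IsCurvatureFieldOn U F.Rm

/-- The derivation `e_a` of scalars. -/
def d (a : Fin 4) (f : Scalar) : Scalar := dirDeriv (F.t.e a) f

/-- `Γ^a_{bc}`: `∇_{e_c} e_b = Γ^a_{bc} e_a`. -/
def Γup (a b c : Fin 4) : Scalar := fun x => ∑ f, eta a f * F.Γ f b c x

/-- The commutation coefficients `γ^c_{ab} = Γ^c_{ba} - Γ^c_{ab}` of a torsion-free connection. -/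
def comm (c a b : Fin 4) : Scalar := fun x => F.Γup c b a x - F.Γup c a b x

/-! ### Tensorial form of the equations -/

/-- The commutator relations `[e_a, e_b] = γ^c_{ab} e_c` at a point. -/
def CommutatorsAt (x : Coord) : Prop :=
  ∀ a b i, F.d a (fun y => F.t.e b y i) x - F.d b (fun y => F.t.e a y i) x
    = ∑ c, F.comm c a b x * F.t.e c x i

/-- The Jacobi equations `e_{[a} γ^d_{bc]} - γ^d_{e[a} γ^e_{bc]} = 0`. -/
def JacobiAt (x : Coord) : Prop :=
  ∀ a b c f,
    (F.d a (F.comm f b c) x - ∑ h, F.comm f h a x * F.comm h b c x)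
    + (F.d b (F.comm f c a) x - ∑ h, F.comm f h b x * F.comm h c a x)
    + (F.d c (F.comm f a b) x - ∑ h, F.comm f h c x * F.comm h a b x) = 0

/-- The right-hand side of the second Cartan equations, first index lowered:
`Γ_{abd,c} - Γ_{abc,d} + Γ^e_{bd} Γ_{aec} - Γ^e_{bc} Γ_{aed} - γ^e_{cd} Γ_{abe}`. -/
def cartan (a b c f : Fin 4) : Scalar := fun x =>
  F.d c (F.Γ a b f) x - F.d f (F.Γ a b c) x
    + ∑ h, (F.Γup h b f x * F.Γ a h c x - F.Γup h b c x * F.Γ a h f x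
        - F.comm h c f x * F.Γ a b h x)

/-- The second Cartan equations. -/
def CartanAt (x : Coord) : Prop :=
  ∀ a b c f, F.Rm a b c f x = F.cartan a b c f x

/-- Tetrad components `w^a_{;c}` of the covariant derivative of the vector `w^a e_a`. -/
def cov1 (w : Fin 4 → Scalar) (a c : Fin 4) : Scalar := fun x =>
  F.d c (w a) x + ∑ b, F.Γup a b c x * w b x

/-- Tetrad components `w^a_{;c;f}` of the second covariant derivative of `w^a e_a`. -/
def cov2 (w : Fin 4 → Scalar) (a c f : Fin 4) : Scalar := fun x =>
  F.d f (F.cov1 w a c) x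
    + ∑ b, (F.Γup a b f x * F.cov1 w b c x - F.Γup b c f x * F.cov1 w a b x)

/-- The tetrad components `k^a = δ^a_4` of `k`. -/
def kComp (a : Fin 4) : Scalar := fun _ => if a = 3 then 1 else 0

/-- The Ricci equations `k^a_{;c;d} - k^a_{;d;c} = R^a_{bdc} k^b` for `k`. -/
def RicciAt (x : Coord) : Prop :=
  ∀ a c f, F.cov2 kComp a c f x - F.cov2 kComp a f c x
    = ∑ b, (∑ h, eta a h * F.Rm h b f c x) * kComp b x

/-- Tetrad components `R_{abcf;h}` of the covariant derivative of the candidate Riemann tensor. -/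
def covRm (a b c f h : Fin 4) : Scalar := fun x =>
  F.d h (F.Rm a b c f) x
    - ∑ i, (F.Γup i a h x * F.Rm i b c f x + F.Γup i b h x * F.Rm a i c f x
        + F.Γup i c h x * F.Rm a b i f x + F.Γup i f h x * F.Rm a b c i x)

/-- The (second) Bianchi equations `R_{ab[cf;h]} = 0`. -/
def BianchiAt (x : Coord) : Prop :=
  ∀ a b c f h, F.covRm a b c f h x + F.covRm a b f h c x + F.covRm a b h c f x = 0

/-! ### Newman-Penrose variables

Indices: `0 = m`, `1 = m̄`, `2 = ℓ`, `3 = k`; e.g. `k_{a;b} m^a k^b = Γ_{144}` is `F.Γ 0 3 3`. -/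

/-- `D = k^a ∂_a`. -/
def D (f : Scalar) : Scalar := F.d 3 f

/-- `Δ = ℓ^a ∂_a`. -/
def Δ (f : Scalar) : Scalar := F.d 2 f

/-- `δ = m^a ∂_a`. -/
def δ (f : Scalar) : Scalar := F.d 0 f

/-- `δ̄ = m̄^a ∂_a`. -/
def δb (f : Scalar) : Scalar := F.d 1 f

/-- `κ = -k_{a;b} m^a k^b`. -/
def κ : Scalar := -F.Γ 0 3 3

/-- `ρ = -k_{a;b} m^a m̄^b`. -/
def ρ : Scalar := -F.Γ 0 3 1

/-- `σ = -k_{a;b} m^a m^b`. -/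
def σ : Scalar := -F.Γ 0 3 0

/-- `τ = -k_{a;b} m^a ℓ^b`. -/
def τ : Scalar := -F.Γ 0 3 2

/-- `ν = ℓ_{a;b} m̄^a ℓ^b`. -/
def ν : Scalar := F.Γ 1 2 2

/-- `μ = ℓ_{a;b} m̄^a m^b`. -/
def μ : Scalar := F.Γ 1 2 0

/-- `λ = ℓ_{a;b} m̄^a m̄^b`. -/
def lam : Scalar := F.Γ 1 2 1

/-- `π = ℓ_{a;b} m̄^a k^b`. -/
def π : Scalar := F.Γ 1 2 3

/-- `ε = -(1/2) (k_{a;b} ℓ^a k^b - m_{a;b} m̄^a k^b)`. -/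
def ε : Scalar := fun x => -(1 / 2) * (F.Γ 2 3 3 x - F.Γ 1 0 3 x)

/-- `β = -(1/2) (k_{a;b} ℓ^a m^b - m_{a;b} m̄^a m^b)`. -/
def β : Scalar := fun x => -(1 / 2) * (F.Γ 2 3 0 x - F.Γ 1 0 0 x)

/-- `γ = (1/2) (ℓ_{a;b} k^a ℓ^b - m̄_{a;b} m^a ℓ^b)`. -/
def γ : Scalar := fun x => (1 / 2) * (F.Γ 3 2 2 x - F.Γ 0 1 2 x)

/-- `α = (1/2) (ℓ_{a;b} k^a m̄^b - m̄_{a;b} m^a m̄^b)`. -/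
def α : Scalar := fun x => (1 / 2) * (F.Γ 3 2 1 x - F.Γ 0 1 1 x)

/-- The Ricci tensor `R_{bd} = R^c_{bcd}`. -/
def Ric (b f : Fin 4) : Scalar := fun x => ∑ c, ∑ h, eta c h * F.Rm h b c f x

/-- The curvature scalar. -/
def R : Scalar := fun x => ∑ b, ∑ f, eta b f * F.Ric b f x

/-- The Weyl tensor
`C_{abcd} = R_{abcd} - (g_{a[c} R_{d]b} + g_{b[d} R_{c]a}) + (1/3) R g_{a[c} g_{d]b}`. -/
def Weyl (a b c f : Fin 4) : Scalar := fun x =>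
  F.Rm a b c f x
    - (1 / 2) * (eta a c * F.Ric f b x - eta a f * F.Ric c b x
        + eta b f * F.Ric c a x - eta b c * F.Ric f a x)
    + (1 / 6) * F.R x * (eta a c * eta f b - eta a f * eta c b)

/-- `Ψ₀ = C_{abcd} k^a m^b k^c m^d`. -/
def Ψ0 : Scalar := F.Weyl 3 0 3 0

/-- `Ψ₁ = C_{abcd} k^a ℓ^b k^c m^d`. -/
def Ψ1 : Scalar := F.Weyl 3 2 3 0

/-- `Ψ₂ = C_{abcd} k^a m^b m̄^c ℓ^d`. -/
def Ψ2 : Scalar := F.Weyl 3 0 1 2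

/-- `Ψ₃ = C_{abcd} k^a ℓ^b m̄^c ℓ^d`. -/
def Ψ3 : Scalar := F.Weyl 3 2 1 2

/-- `Ψ₄ = C_{abcd} m̄^a ℓ^b m̄^c ℓ^d`. -/
def Ψ4 : Scalar := F.Weyl 1 2 1 2

/-- `Φ₀₀ = (1/2) R_{ab} k^a k^b`. -/
def Φ00 : Scalar := fun x => (1 / 2) * F.Ric 3 3 x

/-- `Φ₀₁ = (1/2) R_{ab} k^a m^b`. -/
def Φ01 : Scalar := fun x => (1 / 2) * F.Ric 3 0 x

/-- `Φ₁₀`, the conjugate of `Φ₀₁`. -/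
def Φ10 : Scalar := star F.Φ01

/-- `Φ₀₂ = (1/2) R_{ab} m^a m^b`. -/
def Φ02 : Scalar := fun x => (1 / 2) * F.Ric 0 0 x

/-- `Φ₂₀`, the conjugate of `Φ₀₂`. -/
def Φ20 : Scalar := star F.Φ02

/-- `Φ₁₁ = (1/4) R_{ab} (k^a ℓ^b + m^a m̄^b)`. -/
def Φ11 : Scalar := fun x => (1 / 4) * (F.Ric 3 2 x + F.Ric 0 1 x)

/-- `Φ₁₂ = (1/2) R_{ab} ℓ^a m^b`. -/
def Φ12 : Scalar := fun x => (1 / 2) * F.Ric 2 0 x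

/-- `Φ₂₁`, the conjugate of `Φ₁₂`. -/
def Φ21 : Scalar := star F.Φ12

/-- `Φ₂₂ = (1/2) R_{ab} ℓ^a ℓ^b`. -/
def Φ22 : Scalar := fun x => (1 / 2) * F.Ric 2 2 x

/-! ### The Newman-Penrose equations

`NPn` is the left-hand side minus the right-hand side of the `n`-th equation, which thus reads
`NPn = 0`. -/

def NP1 : Scalar :=
  F.D F.ρ - F.δb F.κ - (F.ρ ^ 2 + F.σ * star F.σ + (F.ε + star F.ε) * F.ρ - star F.κ * F.τ
    - F.κ * (3 * F.α + star F.β - F.π) + F.Φ00)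

def NP2 : Scalar :=
  F.D F.σ - F.δ F.κ - ((F.ρ + star F.ρ) * F.σ + (3 * F.ε - star F.ε) * F.σ
    - (F.τ - star F.π + star F.α + 3 * F.β) * F.κ + F.Ψ0)

def NP3 : Scalar :=
  F.D F.τ - F.Δ F.κ - ((F.τ + star F.π) * F.ρ + (star F.τ + F.π) * F.σ + (F.ε - star F.ε) * F.τ
    - (3 * F.γ + star F.γ) * F.κ + F.Ψ1 + F.Φ01)

def NP4 : Scalar :=
  F.D F.α - F.δb F.ε - ((F.ρ + star F.ε - 2 * F.ε) * F.α + F.β * star F.σ - star F.β * F.ε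
    - F.κ * F.lam - star F.κ * F.γ + (F.ε + F.ρ) * F.π + F.Φ10)

def NP5 : Scalar :=
  F.D F.β - F.δ F.ε - ((F.α + F.π) * F.σ + (star F.ρ - star F.ε) * F.β - (F.μ + F.γ) * F.κ
    - (star F.α - star F.π) * F.ε + F.Ψ1)

def NP6 : Scalar :=
  F.D F.γ - F.Δ F.ε - ((F.τ + star F.π) * F.α + (star F.τ + F.π) * F.β - (F.ε + star F.ε) * F.γ
    - (F.γ + star F.γ) * F.ε + F.τ * F.π - F.ν * F.κ + F.Ψ2 + F.Φ11 - F.R / 24)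

def NP7 : Scalar :=
  F.D F.lam - F.δb F.π - (F.ρ * F.lam + star F.σ * F.μ + F.π ^ 2 + (F.α - star F.β) * F.π
    - F.ν * star F.κ - (3 * F.ε - star F.ε) * F.lam + F.Φ20)

def NP8 : Scalar :=
  F.D F.μ - F.δ F.π - (star F.ρ * F.μ + F.σ * F.lam + F.π * star F.π - (F.ε + star F.ε) * F.μ
    - F.π * (star F.α - F.β) - F.κ * F.ν + F.Ψ2 + F.R / 12)

def NP9 : Scalar :=
  F.D F.ν - F.Δ F.π - ((F.π + star F.τ) * F.μ + (star F.π + F.τ) * F.lam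
    + (F.γ - star F.γ) * F.π - (3 * F.ε + star F.ε) * F.ν + F.Ψ3 + F.Φ21)

def NP10 : Scalar :=
  F.Δ F.lam - F.δb F.ν - (-(F.μ + star F.μ) * F.lam - (3 * F.γ - star F.γ) * F.lam
    + (3 * F.α + star F.β + F.π - star F.τ) * F.ν - F.Ψ4)

def NP11 : Scalar :=
  F.δ F.ρ - F.δb F.σ - (F.ρ * (star F.α + F.β) - F.σ * (3 * F.α - star F.β)
    + (F.ρ - star F.ρ) * F.τ + (F.μ - star F.μ) * F.κ - F.Ψ1 + F.Φ01)

def NP12 : Scalar :=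
  F.δ F.α - F.δb F.β - (F.μ * F.ρ - F.lam * F.σ + F.α * star F.α + F.β * star F.β
    - 2 * F.α * F.β + F.γ * (F.ρ - star F.ρ) + F.ε * (F.μ - star F.μ) - F.Ψ2 + F.Φ11 + F.R / 24)

def NP13 : Scalar :=
  F.δ F.lam - F.δb F.μ - ((F.ρ - star F.ρ) * F.ν + (F.μ - star F.μ) * F.π
    + F.μ * (F.α + star F.β) + F.lam * (star F.α - 3 * F.β) - F.Ψ3 + F.Φ21)

def NP14 : Scalar :=
  F.δ F.ν - F.Δ F.μ - (F.μ ^ 2 + F.lam * star F.lam + (F.γ + star F.γ) * F.μ - star F.ν * F.π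
    + (F.τ - 3 * F.β - star F.α) * F.ν + F.Φ22)

def NP15 : Scalar :=
  F.δ F.γ - F.Δ F.β - ((F.τ - star F.α - F.β) * F.γ + F.μ * F.τ - F.σ * F.ν - F.ε * star F.ν
    - F.β * (F.γ - star F.γ - F.μ) + F.α * star F.lam + F.Φ12)

def NP16 : Scalar :=
  F.δ F.τ - F.Δ F.σ - (F.μ * F.σ + star F.lam * F.ρ + (F.τ + F.β - star F.α) * F.τ
    - (3 * F.γ - star F.γ) * F.σ - F.κ * star F.ν + F.Φ02)

def NP17 : Scalar :=
  F.Δ F.ρ - F.δb F.τ - (-(F.ρ * star F.μ + F.σ * F.lam) + (star F.β - F.α - star F.τ) * F.τ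
    + (F.γ + star F.γ) * F.ρ + F.ν * F.κ - F.Ψ2 - F.R / 12)

def NP18 : Scalar :=
  F.Δ F.α - F.δb F.γ - ((F.ρ + F.ε) * F.ν - (F.τ + F.β) * F.lam + (star F.γ - star F.μ) * F.α
    + (star F.β - star F.τ) * F.γ - F.Ψ3)

/-- All eighteen Newman-Penrose equations hold at `x`. -/
def AllNPAt (x : Coord) : Prop :=
  F.NP1 x = 0 ∧ F.NP2 x = 0 ∧ F.NP3 x = 0 ∧ F.NP4 x = 0 ∧ F.NP5 x = 0 ∧ F.NP6 x = 0 ∧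
  F.NP7 x = 0 ∧ F.NP8 x = 0 ∧ F.NP9 x = 0 ∧ F.NP10 x = 0 ∧ F.NP11 x = 0 ∧ F.NP12 x = 0 ∧
  F.NP13 x = 0 ∧ F.NP14 x = 0 ∧ F.NP15 x = 0 ∧ F.NP16 x = 0 ∧ F.NP17 x = 0 ∧ F.NP18 x = 0

/-- The Jacobi part of the Newman-Penrose equations. -/
def JacobiNPAt (x : Coord) : Prop :=
  (star F.NP1 - F.NP1) x = 0 ∧
  (star F.NP14 - F.NP14) x = 0 ∧
  (star F.NP12 + star F.NP8 - F.NP12 - F.NP8) x = 0 ∧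
  (star F.NP6 - F.NP6 + F.NP8 - star F.NP8) x = 0 ∧
  (F.NP16 - star F.NP7) x = 0 ∧
  (F.NP17 + F.NP8) x = 0 ∧
  (2 * F.NP4 - star F.NP3 - star F.NP11) x = 0 ∧
  (2 * F.NP5 - F.NP3 + F.NP11) x = 0 ∧
  (2 * F.NP15 - star F.NP9 - star F.NP13) x = 0 ∧
  (2 * F.NP18 + F.NP9 - F.NP13) x = 0

/-- The part of the Newman-Penrose equations given by the Ricci equations for `k`. -/
def RicciNPAt (x : Coord) : Prop :=
  F.NP1 x = 0 ∧ F.NP2 x = 0 ∧ F.NP3 x = 0 ∧ F.NP11 x = 0 ∧ F.NP16 x = 0 ∧ F.NP17 x = 0 ∧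
  (star F.NP4 + F.NP5) x = 0 ∧
  (F.NP15 - star F.NP18) x = 0 ∧
  (star F.NP6 + F.NP6) x = 0 ∧
  (star F.NP12 - F.NP12) x = 0

/-- The field equations not contained in the Jacobi and Ricci parts. -/
def FieldNPAt (x : Coord) : Prop :=
  F.NP10 x = 0 ∧ F.NP13 x = 0 ∧ (F.NP12 + star F.NP12) x = 0 ∧ (F.NP14 + star F.NP14) x = 0

end Fields

end NewmanPenrose

end

/-!
Let `Ω` be the defect of the second Cartan equations, that is, the candidate Riemann tensor minus
the curvature form of the connection. As `Ω` is real and antisymmetric in both pairs of indices, it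
is determined by its self-dual parts, whose components are the Newman-Penrose expressions. The
Jacobi equations say that the cyclic part of `Ω` vanishes, and the Ricci equations that its
contraction with `k` does.

If both hold on an open set, `k` annihilates `Ω` in every slot. The defect satisfies the Bianchi
identity: the curvature form always does, and the candidate Riemann tensor does by hypothesis.
Differentiating `k^b Ω_{abcf} = 0` twice along `k` shows that `Ω` is annihilated by `∇_k k` and
`∇_k ∇_k k` as well. For `κ ≠ 0` these and `k` are linearly independent, and an antisymmetric array
on a four-dimensional space with a three-dimensional kernel is zero.

For the independence of the field equations, take `κ = 1` and let the other spin coefficients be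
linear functions of the coordinates. At the origin only their first derivatives enter, and these can
be chosen so that all other equations hold there while the field equations have prescribed values.
-/

noncomputable section

namespace NewmanPenrose

open Filter Topology

/-! ### Derivatives of scalars -/

section Calculus

variable {v w : VecField} {f g : Scalar} {U : Set Coord} {x : Coord}

theorem differentiableAt_of_contDiffOn {E : Type*} [NormedAddCommGroup E] [NormedSpace ℝ E]
    {f : Coord → E} (hf : ContDiffOn ℝ ∞ f U) (hU : IsOpen U) (hx : x ∈ U) :
    DifferentiableAt ℝ f x :=
  (hf.contDiffAt (hU.mem_nhds hx)).differentiableAt (by simp)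

theorem contDiffOn_fderiv_apply {E : Type*} [NormedAddCommGroup E] [NormedSpace ℝ E]
    {f : Coord → E} (hf : ContDiffOn ℝ ∞ f U) (hU : IsOpen U) (u : Coord) :
    ContDiffOn ℝ ∞ (fun y => fderiv ℝ f y u) U :=
  (hf.fderiv_of_isOpen hU (by simp)).clm_apply contDiffOn_const

theorem contDiffOn_ofReal {f : Coord → ℝ} (hf : ContDiffOn ℝ ∞ f U) :
    ContDiffOn ℝ ∞ (fun y => (f y : ℂ)) U :=
  Complex.ofRealCLM.contDiff.comp_contDiffOn hf

theorem fderiv_ofReal_apply {f : Coord → ℝ} (hf : DifferentiableAt ℝ f x) (u : Coord) :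
    fderiv ℝ (fun y => (f y : ℂ)) x u = (fderiv ℝ f x u : ℂ) := by
  have h : HasFDerivAt (fun y => (f y : ℂ)) (Complex.ofRealCLM.comp (fderiv ℝ f x)) x :=
    Complex.ofRealCLM.hasFDerivAt.comp x hf.hasFDerivAt
  rw [h.fderiv]
  rfl

theorem contDiffOn_dirDeriv (hv : ∀ i, ContDiffOn ℝ ∞ (fun y => v y i) U)
    (hf : ContDiffOn ℝ ∞ f U) (hU : IsOpen U) : ContDiffOn ℝ ∞ (dirDeriv v f) U :=
  ContDiffOn.sum fun i _ => (hv i).mul (contDiffOn_fderiv_apply hf hU _)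

theorem dirDeriv_congr_of_isOpen (hU : IsOpen U) (hx : x ∈ U) (h : ∀ y ∈ U, f y = g y) :
    dirDeriv v f x = dirDeriv v g x := by
  have hfg : f =ᶠ[𝓝 x] g := eventually_of_mem (hU.mem_nhds hx) h
  simp only [dirDeriv, hfg.fderiv_eq]

theorem dirDeriv_star (v : VecField) (f : Scalar) (x : Coord) :
    star (dirDeriv v f x) = dirDeriv (fun y i => star (v y i)) (fun y => star (f y)) x := by
  simp only [dirDeriv, star_sum, star_mul', fderiv_star]
  rfl

theorem dirDeriv_const (v : VecField) (c : ℂ) (x : Coord) : dirDeriv v (fun _ => c) x = 0 := by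
  simp [dirDeriv]

theorem dirDeriv_neg (v : VecField) (f : Scalar) (x : Coord) :
    dirDeriv v (fun y => -f y) x = -dirDeriv v f x := by
  simp only [dirDeriv, fderiv_fun_neg, _root_.neg_apply, mul_neg, Finset.sum_neg_distrib]

theorem dirDeriv_add (hf : DifferentiableAt ℝ f x) (hg : DifferentiableAt ℝ g x) :
    dirDeriv v (fun y => f y + g y) x = dirDeriv v f x + dirDeriv v g x := by
  simp only [dirDeriv, fderiv_fun_add hf hg, _root_.add_apply, mul_add, Finset.sum_add_distrib]

theorem dirDeriv_sub (hf : DifferentiableAt ℝ f x) (hg : DifferentiableAt ℝ g x) :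
    dirDeriv v (fun y => f y - g y) x = dirDeriv v f x - dirDeriv v g x := by
  simp only [dirDeriv, fderiv_fun_sub hf hg, _root_.sub_apply, mul_sub, Finset.sum_sub_distrib]

theorem dirDeriv_mul (hf : DifferentiableAt ℝ f x) (hg : DifferentiableAt ℝ g x) :
    dirDeriv v (fun y => f y * g y) x = dirDeriv v f x * g x + f x * dirDeriv v g x := by
  simp only [dirDeriv, fderiv_fun_mul hf hg, _root_.add_apply, _root_.smul_apply, smul_eq_mul,
    Finset.sum_mul, Finset.mul_sum, ← Finset.sum_add_distrib]
  exact Finset.sum_congr rfl fun _ _ => by ring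

theorem dirDeriv_const_mul (c : ℂ) (hf : DifferentiableAt ℝ f x) :
    dirDeriv v (fun y => c * f y) x = c * dirDeriv v f x := by
  rw [dirDeriv_mul (differentiableAt_const c) hf, dirDeriv_const, zero_mul, zero_add]

theorem dirDeriv_sum {ι : Type*} {s : Finset ι} {f : ι → Scalar}
    (hf : ∀ i ∈ s, DifferentiableAt ℝ (f i) x) :
    dirDeriv v (fun y => ∑ i ∈ s, f i y) x = ∑ i ∈ s, dirDeriv v (f i) x := by
  simp only [dirDeriv, fderiv_fun_sum hf, _root_.sum_apply, Finset.mul_sum]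
  exact Finset.sum_comm

theorem dirDeriv_dirDeriv (hw : ∀ i, DifferentiableAt ℝ (fun y => w y i) x)
    (hf : DifferentiableAt ℝ (fderiv ℝ f) x) :
    dirDeriv v (dirDeriv w f) x
      = ∑ i, dirDeriv v (fun y => w y i) x * fderiv ℝ f x (Pi.single i 1)
        + ∑ i, ∑ j, v x j * w x i *
          fderiv ℝ (fderiv ℝ f) x (Pi.single j 1) (Pi.single i 1) := by
  have hp : ∀ u, HasFDerivAt (fun y => fderiv ℝ f y u) ((fderiv ℝ (fderiv ℝ f) x).flip u) x :=
    fun u => by simpa using hf.hasFDerivAt.clm_apply (hasFDerivAt_const u x)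
  have hd : ∀ i : Fin 4, DifferentiableAt ℝ (fun y => fderiv ℝ f y (Pi.single i 1)) x :=
    fun i => (hp _).differentiableAt
  change dirDeriv v (fun y => ∑ i, w y i * fderiv ℝ f y (Pi.single i 1)) x = _
  rw [dirDeriv_sum fun i _ => (hw i).fun_mul (hd i), ← Finset.sum_add_distrib]
  refine Finset.sum_congr rfl fun i _ => ?_
  rw [dirDeriv_mul (hw i) (hd i)]
  simp only [dirDeriv, (hp _).fderiv, ContinuousLinearMap.flip_apply, Finset.mul_sum]
  congr 1
  exact Finset.sum_congr rfl fun j _ => by ring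

theorem dirDeriv_dirDeriv_sub (hv : ∀ i, DifferentiableAt ℝ (fun y => v y i) x)
    (hw : ∀ i, DifferentiableAt ℝ (fun y => w y i) x) (hf : ContDiffAt ℝ 2 f x) :
    dirDeriv v (dirDeriv w f) x - dirDeriv w (dirDeriv v f) x
      = ∑ i, (dirDeriv v (fun y => w y i) x - dirDeriv w (fun y => v y i) x)
        * fderiv ℝ f x (Pi.single i 1) := by
  have hf' : DifferentiableAt ℝ (fderiv ℝ f) x :=
    (hf.fderiv_right (m := 1) (by norm_num)).differentiableAt (by simp)
  have hsymm : IsSymmSndFDerivAt ℝ f x :=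
    hf.isSymmSndFDerivAt (by rw [minSmoothness_of_isRCLikeNormedField])
  have hvw : ∑ i, ∑ j, w x j * v x i * fderiv ℝ (fderiv ℝ f) x (Pi.single j 1) (Pi.single i 1)
      = ∑ i, ∑ j, v x j * w x i *
        fderiv ℝ (fderiv ℝ f) x (Pi.single j 1) (Pi.single i 1) := by
    rw [Finset.sum_comm]
    refine Finset.sum_congr rfl fun i _ => Finset.sum_congr rfl fun j _ => ?_
    rw [hsymm (Pi.single i 1), mul_comm (w x i)]
  rw [dirDeriv_dirDeriv hw hf', dirDeriv_dirDeriv hv hf', hvw]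
  simp only [sub_mul, Finset.sum_sub_distrib]
  ring

end Calculus

/-! ### Antisymmetric arrays -/

theorem eq_zero_of_antisymm_of_row_eq_mul {ι K : Type*} [NonUnitalNonAssocRing K]
    [IsAddTorsionFree K] {A : ι → ι → K} (h : ∀ a b, A a b = -A b a) {r : ι → K} {o : ι}
    (hrow : ∀ a b, A a b = r a * A o b) (a b : ι) : A a b = 0 := by
  have ho : A o o = 0 := self_eq_neg.mp (h o o)
  rw [hrow, h, hrow, ho, mul_zero, neg_zero, mul_zero]

theorem eq_zero_of_antisymm_of_annihilated {K : Type*} [Field K] [CharZero K]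
    {A : Fin 4 → Fin 4 → K} (h : ∀ a b, A a b = -A b a) (hrow : ∀ b, A 3 b = 0) {v w : Fin 4 → K}
    (hv : ∀ b, ∑ a, v a * A a b = 0) (hv2 : v 2 = 0) (hv1 : v 1 ≠ 0)
    (hw : ∀ b, ∑ a, w a * A a b = 0) (hw2 : w 2 ≠ 0) (a b : Fin 4) : A a b = 0 := by
  have hrow1 (b) : A 1 b = -(v 0 / v 1) * A 0 b := by
    have hb := hv b
    rw [Fin.sum_univ_four, hv2, hrow] at hb
    field_simp
    linear_combination hb
  have hrow2 (b) : A 2 b = (w 1 * v 0 / v 1 - w 0) / w 2 * A 0 b := by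
    have hb := hw b
    rw [Fin.sum_univ_four, hrow, hrow1] at hb
    field_simp at hb ⊢
    linear_combination hb
  refine eq_zero_of_antisymm_of_row_eq_mul (o := 0) h
    (r := ![1, -(v 0 / v 1), (w 1 * v 0 / v 1 - w 0) / w 2, 0]) (fun a b => ?_) a b
  fin_cases a
  · exact (one_mul _).symm
  · exact hrow1 b
  · exact hrow2 b
  · exact (hrow b).trans (zero_mul _).symm

section Antisymmetric

variable {ι R : Type*} [LinearOrder ι] [AddGroup R] [IsAddTorsionFree R]

theorem eq_zero_of_antisymm_of_lt {A : ι → ι → R} (h : ∀ a b, A a b = -A b a)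
    (hlt : ∀ a b, a < b → A a b = 0) (a b : ι) : A a b = 0 := by
  rcases lt_trichotomy a b with hab | rfl | hab
  · exact hlt a b hab
  · exact self_eq_neg.mp (h a a)
  · rw [h, hlt b a hab, neg_zero]

theorem eq_zero_of_alternating_of_lt {T : ι → ι → ι → R} (hcycle : ∀ a b c, T a b c = T b c a)
    (hswap : ∀ a b c, T a b c = -T b a c) (hlt : ∀ a b c, a < b → b < c → T a b c = 0)
    (a b c : ι) : T a b c = 0 := by
  have hdiag : ∀ a b, T a a b = 0 := fun a b => self_eq_neg.mp (hswap a a b)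
  refine eq_zero_of_antisymm_of_lt (A := fun a b => T a b c) (hswap · · c) (fun a b hab => ?_) a b
  rcases lt_trichotomy b c with hbc | rfl | hcb
  · exact hlt a b c hab hbc
  · rw [hcycle, hdiag]
  · rw [← hcycle]
    rcases lt_trichotomy c a with hca | rfl | hac
    · exact hlt c a b hca hab
    · exact hdiag c b
    · rw [hswap, hlt a c b hac hcb, neg_zero]

end Antisymmetric

/-! ### Real biforms -/

@[simp] theorem conjIdx_zero : conjIdx 0 = 1 := rfl

@[simp] theorem conjIdx_one : conjIdx 1 = 0 := rfl

@[simp] theorem conjIdx_two : conjIdx 2 = 2 := rfl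

@[simp] theorem conjIdx_three : conjIdx 3 = 3 := rfl

@[simp] theorem conjIdx_conjIdx (a : Fin 4) : conjIdx (conjIdx a) = a := by
  fin_cases a <;> rfl

theorem eta_sum (f : Fin 4 → ℂ) (a : Fin 4) :
    ∑ h, eta a h * f h = ![f 1, f 0, -f 3, -f 2] a := by
  fin_cases a <;> simp [eta, Fin.sum_univ_four]

theorem eta_mul_eta : eta * eta = 1 := by
  ext i j
  fin_cases i <;> fin_cases j <;> simp [eta, Matrix.mul_apply, Fin.sum_univ_four]

theorem eta_sum_eq_zero_iff {f : Fin 4 → ℂ} : (∀ a, ∑ h, eta a h * f h = 0) ↔ ∀ a, f a = 0 := by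
  refine ⟨fun h => congrFun (?_ : f = 0),
    fun h a => by simp only [h, mul_zero, Finset.sum_const_zero]⟩
  have hf : eta.mulVec f = 0 := funext h
  rw [← Matrix.one_mulVec f, ← eta_mul_eta, ← Matrix.mulVec_mulVec, hf, Matrix.mulVec_zero]

-- The index pairs are oriented as in the directions of the Newman-Penrose equations.
theorem eq_zero_of_antisymm {A : Fin 4 → Fin 4 → ℂ} (h : ∀ a b, A a b = -A b a)
    (h01 : A 0 1 = 0) (h02 : A 0 2 = 0) (h21 : A 2 1 = 0) (h30 : A 3 0 = 0) (h31 : A 3 1 = 0)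
    (h32 : A 3 2 = 0) (a b : Fin 4) : A a b = 0 := by
  refine eq_zero_of_antisymm_of_lt h (fun a b hab => ?_) a b
  fin_cases a <;> fin_cases b <;>
    first | exact absurd hab (by decide) | assumption | exact (h _ _).trans (neg_eq_zero.mpr ‹_›)

/-- The tetrad components of a real tensor that is antisymmetric in its first and in its last pair
of indices, such as a Riemann tensor or the curvature form of a metric connection; the pair symmetry
and the cyclic identity are not imposed. -/
structure IsRealBiform (Ω : Fin 4 → Fin 4 → Fin 4 → Fin 4 → ℂ) : Prop where
  antisymm_left : ∀ a b c f, Ω a b c f = -Ω b a c f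
  antisymm_right : ∀ a b c f, Ω a b c f = -Ω a b f c
  star_eq : ∀ a b c f, star (Ω a b c f) = Ω (conjIdx a) (conjIdx b) (conjIdx c) (conjIdx f)

/-- The sum of the components of `Ω` over the cyclic permutations of the last three indices, which
vanishes for a Riemann tensor. -/
def cyclicSum (Ω : Fin 4 → Fin 4 → Fin 4 → Fin 4 → ℂ) (a b c f : Fin 4) : ℂ :=
  Ω a b c f + Ω a c f b + Ω a f b c

namespace IsRealBiform

variable {Ω : Fin 4 → Fin 4 → Fin 4 → Fin 4 → ℂ} (hΩ : IsRealBiform Ω)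
include hΩ

theorem eq_star (a b c f : Fin 4) :
    Ω a b c f = star (Ω (conjIdx a) (conjIdx b) (conjIdx c) (conjIdx f)) := by
  simp only [hΩ.star_eq, conjIdx_conjIdx]

theorem eq_zero_of_selfDual_eq_zero (h03 : ∀ c f, Ω 0 3 c f = 0) (h12 : ∀ c f, Ω 1 2 c f = 0)
    (h01 : ∀ c f, Ω 0 1 c f - Ω 3 2 c f = 0) (a b c f : Fin 4) : Ω a b c f = 0 := by
  have h32 (c f) : Ω 3 2 c f = 0 := by
    have hconj := hΩ.eq_star 0 1 c f
    rw [conjIdx_zero, conjIdx_one, hΩ.antisymm_left 1 0, sub_eq_zero.mp (h01 c f),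
      sub_eq_zero.mp (h01 _ _), star_neg, hΩ.star_eq] at hconj
    simp only [conjIdx_three, conjIdx_two, conjIdx_conjIdx] at hconj
    exact self_eq_neg.mp hconj
  refine eq_zero_of_antisymm (hΩ.antisymm_left · · c f) ?_ ?_ ?_ ?_ ?_ (h32 c f) a b
  · rw [sub_eq_zero.mp (h01 c f), h32]
  · rw [hΩ.eq_star, conjIdx_zero, conjIdx_two, h12, star_zero]
  · rw [hΩ.antisymm_left, h12, neg_zero]
  · rw [hΩ.antisymm_left, h03, neg_zero]
  · rw [hΩ.antisymm_left, hΩ.eq_star, conjIdx_one, conjIdx_three, h03, star_zero, neg_zero]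

theorem right_three_eq_zero (h03 : ∀ c f, Ω 0 3 c f = 0) (h01 : Ω 3 2 0 1 = 0)
    (h02 : Ω 3 2 0 2 = 0) (h30 : Ω 3 2 3 0 = 0) (h32 : Ω 3 2 3 2 = 0) (a c f : Fin 4) :
    Ω a 3 c f = 0 := by
  have hconj {c f} (h : Ω 3 2 c f = 0) : Ω 3 2 (conjIdx c) (conjIdx f) = 0 := by
    rw [hΩ.eq_star, conjIdx_three, conjIdx_two, conjIdx_conjIdx, conjIdx_conjIdx, h, star_zero]
  have h32' (c f) : Ω 3 2 c f = 0 :=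
    eq_zero_of_antisymm (hΩ.antisymm_right 3 2) h01 h02
      (by rw [hΩ.antisymm_right, neg_eq_zero]; exact hconj h02) h30 (hconj h30) h32 c f
  fin_cases a
  · exact h03 c f
  · refine (hΩ.eq_star 1 3 c f).trans ?_
    rw [conjIdx_one, conjIdx_three, h03, star_zero]
  · exact (hΩ.antisymm_left 2 3 c f).trans (neg_eq_zero.mpr (h32' c f))
  · exact self_eq_neg.mp (hΩ.antisymm_left 3 3 c f)

theorem cyclicSum_swap (a b c f : Fin 4) : cyclicSum Ω a b c f = -cyclicSum Ω a c b f := by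
  unfold cyclicSum
  linear_combination hΩ.antisymm_right a b c f + hΩ.antisymm_right a c f b
    + hΩ.antisymm_right a f b c

theorem star_cyclicSum (a b c f : Fin 4) :
    star (cyclicSum Ω a b c f) =
      cyclicSum Ω (conjIdx a) (conjIdx b) (conjIdx c) (conjIdx f) := by
  simp only [cyclicSum, star_add, hΩ.star_eq]

theorem cyclicSum_eq_zero (h0012 : cyclicSum Ω 0 0 1 2 = 0) (h0013 : cyclicSum Ω 0 0 1 3 = 0)
    (h0023 : cyclicSum Ω 0 0 2 3 = 0) (h0123 : cyclicSum Ω 0 1 2 3 = 0)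
    (h2012 : cyclicSum Ω 2 0 1 2 = 0) (h2013 : cyclicSum Ω 2 0 1 3 = 0)
    (h2023 : cyclicSum Ω 2 0 2 3 = 0) (h3012 : cyclicSum Ω 3 0 1 2 = 0)
    (h3013 : cyclicSum Ω 3 0 1 3 = 0) (h3023 : cyclicSum Ω 3 0 2 3 = 0) (a b c f : Fin 4) :
    cyclicSum Ω a b c f = 0 := by
  have hvanish (a) (h012 : cyclicSum Ω a 0 1 2 = 0) (h013 : cyclicSum Ω a 0 1 3 = 0)
      (h023 : cyclicSum Ω a 0 2 3 = 0) (h123 : cyclicSum Ω a 1 2 3 = 0) (b c f) :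
      cyclicSum Ω a b c f = 0 := by
    refine eq_zero_of_alternating_of_lt (T := cyclicSum Ω a)
      (fun b c f => by unfold cyclicSum; ring) (hΩ.cyclicSum_swap a) (fun b c f hbc hcf => ?_) b c f
    fin_cases b <;> fin_cases c <;> first | exact absurd hbc (by decide) | skip
    all_goals fin_cases f <;> first | exact absurd hcf (by decide) | assumption
  have hconj {a b c f} (h : cyclicSum Ω a b c f = 0) :
      cyclicSum Ω (conjIdx a) (conjIdx b) (conjIdx c) (conjIdx f) = 0 := by
    rw [← hΩ.star_cyclicSum, h, star_zero]
  have h0 := hvanish 0 h0012 h0013 h0023 h0123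
  fin_cases a
  · exact h0 b c f
  · have h1 := hconj (h0 (conjIdx b) (conjIdx c) (conjIdx f))
    rwa [conjIdx_conjIdx, conjIdx_conjIdx, conjIdx_conjIdx] at h1
  · exact hvanish 2 h2012 h2013 h2023 (hconj h2023) b c f
  · exact hvanish 3 h3012 h3013 h3023 (hconj h3023) b c f

theorem last_eq_zero (hcyclic : ∀ a b c f, cyclicSum Ω a b c f = 0) {k : Fin 4}
    (hk : ∀ a c f, Ω a k c f = 0) (a b c : Fin 4) : Ω a b c k = 0 := by
  have hsymm (a b c) : Ω a b c k = Ω a c b k := by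
    have hsum := hcyclic a b c k
    unfold cyclicSum at hsum
    linear_combination hsum - hk a b c - hΩ.antisymm_right a c k b
  refine self_eq_neg.mp ?_
  calc Ω a b c k = Ω a c b k := hsymm a b c
    _ = -Ω c a b k := hΩ.antisymm_left a c b k
    _ = -Ω c b a k := by rw [hsymm]
    _ = Ω b c a k := by rw [hΩ.antisymm_left c b, neg_neg]
    _ = Ω b a c k := hsymm b c a
    _ = -Ω a b c k := hΩ.antisymm_left b a c k

end IsRealBiform

/-! ### The defect of the second Cartan equations -/

namespace Fields

variable {F : Fields} {U : Set Coord} {x : Coord}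

theorem star_e (t : Tetrad) (a : Fin 4) :
    (fun (y : Coord) i => star (t.e a y i)) = t.e (conjIdx a) := by
  fin_cases a <;> funext y i <;> simp [Tetrad.e]

theorem star_d (F : Fields) (a : Fin 4) (f : Scalar) (x : Coord) :
    star (F.d a f x) = F.d (conjIdx a) (fun y => star (f y)) x := by
  simp only [d, dirDeriv_star, star_e]

theorem Γup_zero (F : Fields) (b c : Fin 4) : F.Γup 0 b c = F.Γ 1 b c := by
  funext x; simp [Γup, eta_sum]

theorem Γup_one (F : Fields) (b c : Fin 4) : F.Γup 1 b c = F.Γ 0 b c := by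
  funext x; simp [Γup, eta_sum]

theorem Γup_two (F : Fields) (b c : Fin 4) : F.Γup 2 b c = fun x => -F.Γ 3 b c x := by
  funext x; simp [Γup, eta_sum]

theorem Γup_three (F : Fields) (b c : Fin 4) : F.Γup 3 b c = fun x => -F.Γ 2 b c x := by
  funext x; simp [Γup, eta_sum]

/-- The components of the difference `Ω` between the candidate Riemann tensor and the curvature form
of the connection. -/
def defect (F : Fields) (a b c f : Fin 4) : Scalar :=
  fun x => F.Rm a b c f x - F.cartan a b c f x

theorem cartanAt_iff_defect : F.CartanAt x ↔ ∀ a b c f, F.defect a b c f x = 0 := by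
  simp only [CartanAt, defect, sub_eq_zero]

theorem cartan_antisymm_right (F : Fields) (a b c f : Fin 4) (x : Coord) :
    F.cartan a b c f x = -F.cartan a b f c x := by
  simp only [cartan, comm, Fin.sum_univ_four]
  ring

namespace IsAdmissibleOn

variable (hF : F.IsAdmissibleOn U)
include hF

theorem conn_differentiableAt (hU : IsOpen U) (hx : x ∈ U) (a b c : Fin 4) :
    DifferentiableAt ℝ (F.Γ a b c) x :=
  differentiableAt_of_contDiffOn (hF.conn_smooth a b c) hU hx

theorem d_conn_antisymm (hU : IsOpen U) (hx : x ∈ U) (h a b c : Fin 4) :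
    F.d h (F.Γ a b c) x = -F.d h (F.Γ b a c) x := by
  simp only [d]
  rw [← dirDeriv_neg]
  exact dirDeriv_congr_of_isOpen hU hx fun y hy => hF.conn_antisymm y hy a b c

theorem star_d_conn (hU : IsOpen U) (hx : x ∈ U) (h a b c : Fin 4) :
    star (F.d h (F.Γ a b c) x) =
      F.d (conjIdx h) (F.Γ (conjIdx a) (conjIdx b) (conjIdx c)) x := by
  rw [star_d]
  exact dirDeriv_congr_of_isOpen hU hx fun y hy => hF.conn_real y hy a b c

theorem star_Γup (hx : x ∈ U) (a b c : Fin 4) :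
    star (F.Γup a b c x) = F.Γup (conjIdx a) (conjIdx b) (conjIdx c) x := by
  have hreal := hF.conn_real x hx
  fin_cases a <;>
    simp only [Fin.zero_eta, Fin.mk_one, Fin.reduceFinMk, Γup_zero, Γup_one, Γup_two, Γup_three,
      star_neg, hreal, conjIdx_zero, conjIdx_one, conjIdx_two, conjIdx_three]

theorem star_comm (hx : x ∈ U) (a b c : Fin 4) :
    star (F.comm a b c x) = F.comm (conjIdx a) (conjIdx b) (conjIdx c) x := by
  simp only [comm, star_sub, hF.star_Γup hx]

theorem star_cartan (hU : IsOpen U) (hx : x ∈ U) (a b c f : Fin 4) :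
    star (F.cartan a b c f x)
      = F.cartan (conjIdx a) (conjIdx b) (conjIdx c) (conjIdx f) x := by
  simp only [cartan, star_add, star_sub, star_mul', hF.star_d_conn hU hx,
    hF.star_Γup hx, hF.star_comm hx, hF.conn_real x hx, Fin.sum_univ_four, conjIdx_zero,
    conjIdx_one, conjIdx_two, conjIdx_three]
  ring

theorem cartan_antisymm_left (hU : IsOpen U) (hx : x ∈ U) (a b c f : Fin 4) :
    F.cartan a b c f x = -F.cartan b a c f x := by
  have hΓ := hF.conn_antisymm x hx
  have hquad (c f) : ∑ h, F.Γup h b f x * F.Γ a h c x = ∑ h, F.Γup h a c x * F.Γ b h f x := by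
    simp only [Fin.sum_univ_four, Γup_zero, Γup_one, Γup_two, Γup_three, hΓ a _ c, hΓ b _ f]
    ring
  have hcomm : ∑ h, F.comm h c f x * F.Γ a b h x = -∑ h, F.comm h c f x * F.Γ b a h x := by
    simp only [hΓ a b, mul_neg, Finset.sum_neg_distrib]
  simp only [cartan, Finset.sum_sub_distrib, hquad, hcomm, hF.d_conn_antisymm hU hx _ a b]
  ring

theorem isRealBiform_defect (hU : IsOpen U) (hx : x ∈ U) :
    IsRealBiform fun a b c f => F.defect a b c f x where
  antisymm_left a b c f := by
    simp only [defect]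
    rw [hF.cartan_antisymm_left hU hx, hF.curv.antisymm_left x hx, neg_sub_neg, neg_sub]
  antisymm_right a b c f := by
    simp only [defect]
    rw [F.cartan_antisymm_right, hF.curv.antisymm_right x hx, neg_sub_neg, neg_sub]
  star_eq a b c f := by
    simp only [defect, star_sub, hF.star_cartan hU hx, hF.curv.real x hx]

end IsAdmissibleOn

/-! ### The Newman-Penrose equations as self-dual parts of the defect -/

/-- The components of the exterior derivative of the one-form `θ_a e^a`, computed with the
commutation coefficients `γ^c_{ab}` of the connection. -/
def extDeriv (F : Fields) (θ : Fin 4 → Scalar) (c f : Fin 4) : Scalar :=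
  fun x => F.d c (θ f) x - F.d f (θ c) x - ∑ h, F.comm h c f x * θ h x

/-- The spin connection form `Γ_{00} = -Γ_{03}` with components `σ, ρ, τ, κ`. Together with
`spin01` and `spin11` it is the self-dual part of the connection, written in the spinor dyad of the
tetrad. -/
def spin00 (F : Fields) : Fin 4 → Scalar := ![F.σ, F.ρ, F.τ, F.κ]

/-- The spin connection form `Γ_{01} = (Γ_{32} - Γ_{01}) / 2` with components `β, α, γ, ε`; on the
right-hand side the indices refer to the tetrad. -/
def spin01 (F : Fields) : Fin 4 → Scalar := ![F.β, F.α, F.γ, F.ε]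

/-- The spin connection form `Γ_{11} = Γ_{12}` with components `μ, λ, ν, π`; on the right-hand side
the indices refer to the tetrad. -/
def spin11 (F : Fields) : Fin 4 → Scalar := ![F.μ, F.lam, F.ν, F.π]

theorem spin00_eq (F : Fields) (c : Fin 4) : F.spin00 c = fun x => -F.Γ 0 3 c x := by
  fin_cases c <;> rfl

theorem spin11_eq (F : Fields) (c : Fin 4) : F.spin11 c = F.Γ 1 2 c := by
  fin_cases c <;> rfl

theorem cartan_eq_extDeriv (F : Fields) (a b c f : Fin 4) (x : Coord) :
    F.cartan a b c f x = F.extDeriv (F.Γ a b) c f x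
      + ∑ h, (F.Γup h b f x * F.Γ a h c x - F.Γup h b c x * F.Γ a h f x) := by
  simp only [cartan, extDeriv, Finset.sum_sub_distrib]
  ring

theorem extDeriv_neg (F : Fields) (θ : Fin 4 → Scalar) (c f : Fin 4) (x : Coord) :
    F.extDeriv (fun a y => -θ a y) c f x = -F.extDeriv θ c f x := by
  simp only [extDeriv, d, dirDeriv_neg, mul_neg, Finset.sum_neg_distrib]
  ring

theorem extDeriv_const_mul_sub (F : Fields) {θ θ' : Fin 4 → Scalar}
    (hθ : ∀ a, DifferentiableAt ℝ (θ a) x) (hθ' : ∀ a, DifferentiableAt ℝ (θ' a) x) (z : ℂ)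
    (c f : Fin 4) :
    F.extDeriv (fun a y => z * (θ a y - θ' a y)) c f x
      = z * (F.extDeriv θ c f x - F.extDeriv θ' c f x) := by
  simp only [extDeriv, d, dirDeriv_const_mul z ((hθ _).fun_sub (hθ' _)),
    dirDeriv_sub (hθ _) (hθ' _), Fin.sum_univ_four]
  ring

theorem extDeriv_congr_of_isOpen (hU : IsOpen U) (hx : x ∈ U) {θ θ' : Fin 4 → Scalar}
    (h : ∀ a, ∀ y ∈ U, θ a y = θ' a y) (c f : Fin 4) :
    F.extDeriv θ c f x = F.extDeriv θ' c f x := by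
  simp only [extDeriv, d, dirDeriv_congr_of_isOpen hU hx (h _), h _ x hx]

namespace IsAdmissibleOn

variable (hF : F.IsAdmissibleOn U)
include hF

theorem conn_self (hx : x ∈ U) (a c : Fin 4) : F.Γ a a c x = 0 :=
  self_eq_neg.mp (hF.conn_antisymm x hx a a c)

theorem spin01_eq (hx : x ∈ U) (c : Fin 4) :
    F.spin01 c x = 1 / 2 * (F.Γ 3 2 c x - F.Γ 0 1 c x) := by
  have h32 := hF.conn_antisymm x hx 3 2
  have h01 := hF.conn_antisymm x hx 0 1
  fin_cases c
  · change -(1 / 2) * (F.Γ 2 3 0 x - F.Γ 1 0 0 x) = 1 / 2 * (F.Γ 3 2 0 x - F.Γ 0 1 0 x)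
    linear_combination -(1 / 2) * h32 0 + 1 / 2 * h01 0
  · rfl
  · rfl
  · change -(1 / 2) * (F.Γ 2 3 3 x - F.Γ 1 0 3 x) = 1 / 2 * (F.Γ 3 2 3 x - F.Γ 0 1 3 x)
    linear_combination -(1 / 2) * h32 3 + 1 / 2 * h01 3

theorem cartan_zero_three (hx : x ∈ U) (c f : Fin 4) :
    F.cartan 0 3 c f x = 2 * (F.spin01 c x * F.spin00 f x - F.spin01 f x * F.spin00 c x)
      - F.extDeriv F.spin00 c f x := by
  have hspin : F.extDeriv F.spin00 c f x = -F.extDeriv (F.Γ 0 3) c f x := by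
    rw [← extDeriv_neg]
    congr 1
    exact funext F.spin00_eq
  rw [cartan_eq_extDeriv, hspin]
  simp only [Fin.sum_univ_four, Γup_zero, Γup_one, Γup_two, Γup_three, hF.conn_self hx,
    hF.conn_antisymm x hx 2 3, hF.spin01_eq hx, spin00_eq]
  ring

theorem cartan_one_two (hx : x ∈ U) (c f : Fin 4) :
    F.cartan 1 2 c f x = F.extDeriv F.spin11 c f x
      + 2 * (F.spin01 c x * F.spin11 f x - F.spin01 f x * F.spin11 c x) := by
  have hspin : F.extDeriv F.spin11 c f x = F.extDeriv (F.Γ 1 2) c f x := by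
    congr 1
    exact funext F.spin11_eq
  rw [cartan_eq_extDeriv, hspin]
  simp only [Fin.sum_univ_four, Γup_zero, Γup_one, Γup_two, Γup_three, hF.conn_self hx,
    hF.conn_antisymm x hx 1 0, hF.spin01_eq hx, spin11_eq]
  ring

theorem half_cartan_three_two_sub (hU : IsOpen U) (hx : x ∈ U) (c f : Fin 4) :
    1 / 2 * (F.cartan 3 2 c f x - F.cartan 0 1 c f x) = F.extDeriv F.spin01 c f x
      + (F.spin00 c x * F.spin11 f x - F.spin00 f x * F.spin11 c x) := by
  have hd := hF.conn_differentiableAt hU hx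
  have hspin : F.extDeriv F.spin01 c f x
      = 1 / 2 * (F.extDeriv (F.Γ 3 2) c f x - F.extDeriv (F.Γ 0 1) c f x) := by
    rw [← F.extDeriv_const_mul_sub (hd 3 2) (hd 0 1)]
    exact extDeriv_congr_of_isOpen hU hx (fun a y hy => hF.spin01_eq hy a) c f
  rw [cartan_eq_extDeriv, cartan_eq_extDeriv, hspin]
  simp only [Fin.sum_univ_four, Γup_zero, Γup_one, Γup_two, Γup_three, hF.conn_self hx,
    hF.conn_antisymm x hx 3 0, hF.conn_antisymm x hx 3 1, hF.conn_antisymm x hx 2 1,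
    spin00_eq, spin11_eq]
  ring

/-! ### Commutation coefficients -/

theorem conn_zero_one (hx : x ∈ U) (c : Fin 4) :
    F.Γ 0 1 c x = star (F.spin01 (conjIdx c) x) - F.spin01 c x := by
  simp only [hF.spin01_eq hx, star_mul', star_sub, star_div₀, star_one, star_ofNat,
    hF.conn_real x hx, conjIdx_conjIdx, conjIdx_zero, conjIdx_one, conjIdx_two, conjIdx_three,
    hF.conn_antisymm x hx 1 0]
  ring

theorem conn_three_two (hx : x ∈ U) (c : Fin 4) :
    F.Γ 3 2 c x = star (F.spin01 (conjIdx c) x) + F.spin01 c x := by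
  simp only [hF.spin01_eq hx, star_mul', star_sub, star_div₀, star_one, star_ofNat,
    hF.conn_real x hx, conjIdx_conjIdx, conjIdx_zero, conjIdx_one, conjIdx_two, conjIdx_three,
    hF.conn_antisymm x hx 1 0]
  ring

theorem conn_zero_two (hx : x ∈ U) (c : Fin 4) :
    F.Γ 0 2 c x = star (F.spin11 (conjIdx c) x) := by
  simp only [spin11_eq, hF.conn_real x hx, conjIdx_conjIdx, conjIdx_one, conjIdx_two]

theorem conn_one_three (hx : x ∈ U) (c : Fin 4) :
    F.Γ 1 3 c x = -star (F.spin00 (conjIdx c) x) := by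
  simp only [spin00_eq, star_neg, hF.conn_real x hx, conjIdx_conjIdx, conjIdx_zero, conjIdx_three,
    neg_neg]

theorem comm_eq (hx : x ∈ U) :
    (F.comm · 0 1 x) = ![star (F.β x) - F.α x, star (F.α x) - F.β x, F.ρ x - star (F.ρ x),
      F.μ x - star (F.μ x)] ∧
    (F.comm · 0 2 x) = ![F.μ x + star (F.γ x) - F.γ x, star (F.lam x),
      F.τ x - star (F.α x) - F.β x, -star (F.ν x)] ∧
    (F.comm · 2 1 x) = ![-F.lam x, star (F.γ x) - F.γ x - star (F.μ x),
      star (F.β x) + F.α x - star (F.τ x), F.ν x] ∧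
    (F.comm · 3 0 x) = ![star (F.ρ x) + F.ε x - star (F.ε x), F.σ x, -F.κ x,
      star (F.π x) - star (F.α x) - F.β x] ∧
    (F.comm · 3 1 x) = ![star (F.σ x), F.ρ x + star (F.ε x) - F.ε x, -star (F.κ x),
      F.π x - F.α x - star (F.β x)] ∧
    (F.comm · 3 2 x) = ![F.π x + star (F.τ x), star (F.π x) + F.τ x, -(F.ε x + star (F.ε x)),
      -(F.γ x + star (F.γ x))] := by
  have hΓ := hF.conn_antisymm x hx
  have h03 (c) : F.Γ 0 3 c x = -F.spin00 c x := by rw [spin00_eq, neg_neg]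
  have h12 (c) : F.Γ 1 2 c x = F.spin11 c x := by rw [spin11_eq]
  refine ⟨?_, ?_, ?_, ?_, ?_, ?_⟩ <;> funext h <;> fin_cases h <;>
    simp only [comm, Γup_zero, Γup_one, Γup_two, Γup_three, Fin.zero_eta, Fin.mk_one,
      Fin.reduceFinMk, hΓ 1 0, hΓ 2 0, hΓ 2 1, hΓ 2 3, hΓ 3 0, hΓ 3 1, hF.conn_self hx,
      hF.conn_zero_one hx, hF.conn_zero_two hx, hF.conn_one_three hx, hF.conn_three_two hx, h03,
      h12, conjIdx_zero, conjIdx_one, conjIdx_two, conjIdx_three, spin00, spin01, spin11,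
      Matrix.cons_val] <;>
    ring

end IsAdmissibleOn

/-! ### Ricci and Weyl scalars -/

theorem Ric_apply (F : Fields) (b f : Fin 4) (x : Coord) :
    F.Ric b f x = F.Rm 1 b 0 f x + F.Rm 0 b 1 f x - F.Rm 3 b 2 f x - F.Rm 2 b 3 f x := by
  simp only [Ric, Fin.sum_univ_four, eta, Matrix.of_apply, Matrix.cons_val]
  ring

theorem R_apply (F : Fields) (x : Coord) :
    F.R x = F.Ric 1 0 x + F.Ric 0 1 x - F.Ric 3 2 x - F.Ric 2 3 x := by
  simp only [R, Fin.sum_univ_four, eta, Matrix.of_apply, Matrix.cons_val]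
  ring

namespace IsAdmissibleOn

variable (hF : F.IsAdmissibleOn U)
include hF

theorem star_Ric (hx : x ∈ U) (b f : Fin 4) :
    star (F.Ric b f x) = F.Ric (conjIdx b) (conjIdx f) x := by
  simp only [Ric_apply, star_add, star_sub, hF.curv.real x hx, conjIdx_zero, conjIdx_one,
    conjIdx_two, conjIdx_three]
  ring

theorem Rm_zero_three (hx : x ∈ U) :
    F.Rm 0 3 3 1 x = -F.Φ00 x ∧
    F.Rm 0 3 3 0 x = -F.Ψ0 x ∧
    F.Rm 0 3 3 2 x = -(F.Ψ1 x + F.Φ01 x) ∧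
    F.Rm 0 3 0 1 x = F.Ψ1 x - F.Φ01 x ∧
    F.Rm 0 3 0 2 x = -F.Φ02 x ∧
    F.Rm 0 3 2 1 x = F.Ψ2 x + F.R x / 12 := by
  have hleft := hF.curv.antisymm_left x hx
  have hright := hF.curv.antisymm_right x hx
  have hpair := hF.curv.pair_symm x hx
  refine ⟨?_, ?_, ?_, ?_, ?_, ?_⟩ <;>
    simp only [Ψ0, Ψ1, Ψ2, Φ00, Φ01, Φ02, Weyl, R_apply, Ric_apply, eta, Matrix.of_apply,
      Matrix.cons_val] <;>
    grind

theorem Rm_one_two (hx : x ∈ U) :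
    F.Rm 1 2 3 1 x = F.Φ20 x ∧
    F.Rm 1 2 3 0 x = F.Ψ2 x + F.R x / 12 ∧
    F.Rm 1 2 3 2 x = F.Ψ3 x + F.Φ21 x ∧
    F.Rm 1 2 0 1 x = F.Φ21 x - F.Ψ3 x ∧
    F.Rm 1 2 0 2 x = F.Φ22 x ∧
    F.Rm 1 2 2 1 x = -F.Ψ4 x := by
  have hΦ20 : F.Φ20 x = 1 / 2 * F.Ric 1 1 x := by
    simp [Φ20, Φ02, hF.star_Ric hx]
  have hΦ21 : F.Φ21 x = 1 / 2 * F.Ric 2 1 x := by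
    simp [Φ21, Φ12, hF.star_Ric hx]
  have hleft := hF.curv.antisymm_left x hx
  have hright := hF.curv.antisymm_right x hx
  have hpair := hF.curv.pair_symm x hx
  refine ⟨?_, ?_, ?_, ?_, ?_, ?_⟩ <;>
    simp only [Ψ2, Ψ3, Ψ4, hΦ20, hΦ21, Φ22, Weyl, R_apply, Ric_apply, eta, Matrix.of_apply,
      Matrix.cons_val] <;>
    grind

theorem half_Rm_three_two_sub (hx : x ∈ U) :
    1 / 2 * (F.Rm 3 2 3 1 x - F.Rm 0 1 3 1 x) = F.Φ10 x ∧
    1 / 2 * (F.Rm 3 2 3 0 x - F.Rm 0 1 3 0 x) = F.Ψ1 x ∧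
    1 / 2 * (F.Rm 3 2 3 2 x - F.Rm 0 1 3 2 x) = F.Ψ2 x + F.Φ11 x - F.R x / 24 ∧
    1 / 2 * (F.Rm 3 2 0 1 x - F.Rm 0 1 0 1 x) = F.Φ11 x - F.Ψ2 x + F.R x / 24 ∧
    1 / 2 * (F.Rm 3 2 0 2 x - F.Rm 0 1 0 2 x) = F.Φ12 x ∧
    1 / 2 * (F.Rm 3 2 2 1 x - F.Rm 0 1 2 1 x) = -F.Ψ3 x := by
  have hΦ10 : F.Φ10 x = 1 / 2 * F.Ric 3 1 x := by
    simp [Φ10, Φ01, hF.star_Ric hx]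
  have hleft := hF.curv.antisymm_left x hx
  have hright := hF.curv.antisymm_right x hx
  have hpair := hF.curv.pair_symm x hx
  have hcyc := hF.curv.cyclic x hx
  refine ⟨?_, ?_, ?_, ?_, ?_, ?_⟩ <;>
    simp only [Ψ1, Ψ2, Ψ3, hΦ10, Φ11, Φ12, Weyl, R_apply, Ric_apply, eta, Matrix.of_apply,
      Matrix.cons_val] <;>
    grind

end IsAdmissibleOn

/-! ### Newman-Penrose expressions as components of the defect -/

theorem extDeriv_eq_of_comm_eq (F : Fields) {c f : Fin 4} {v : Fin 4 → ℂ}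
    (hv : (F.comm · c f x) = v) (θ : Fin 4 → Scalar) :
    F.extDeriv θ c f x = F.d c (θ f) x - F.d f (θ c) x
      - (v 0 * θ 0 x + v 1 * θ 1 x + v 2 * θ 2 x + v 3 * θ 3 x) := by
  simp only [extDeriv, ← hv, Fin.sum_univ_four]

namespace IsAdmissibleOn

variable (hF : F.IsAdmissibleOn U)
include hF

theorem defect_zero_three (hx : x ∈ U) :
    F.defect 0 3 3 1 x = F.NP1 x ∧
    F.defect 0 3 3 0 x = F.NP2 x ∧
    F.defect 0 3 3 2 x = F.NP3 x ∧
    F.defect 0 3 0 1 x = F.NP11 x ∧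
    F.defect 0 3 0 2 x = F.NP16 x ∧
    F.defect 0 3 2 1 x = F.NP17 x := by
  obtain ⟨h01, h02, h21, h30, h31, h32⟩ := hF.comm_eq hx
  obtain ⟨r31, r30, r32, r01, r02, r21⟩ := hF.Rm_zero_three hx
  refine ⟨?_, ?_, ?_, ?_, ?_, ?_⟩ <;>
    simp only [defect, hF.cartan_zero_three hx, r31, r30, r32, r01, r02, r21,
      F.extDeriv_eq_of_comm_eq h01, F.extDeriv_eq_of_comm_eq h02, F.extDeriv_eq_of_comm_eq h21,
      F.extDeriv_eq_of_comm_eq h30, F.extDeriv_eq_of_comm_eq h31, F.extDeriv_eq_of_comm_eq h32,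
      spin00, spin01, Matrix.cons_val, NP1, NP2, NP3, NP11, NP16, NP17, D, Δ, δ, δb,
      Pi.sub_apply, Pi.add_apply, Pi.mul_apply, Pi.pow_apply, Pi.star_apply, Pi.ofNat_apply,
      Pi.neg_apply, Pi.div_apply] <;>
    ring

theorem neg_defect_one_two (hx : x ∈ U) :
    -F.defect 1 2 3 1 x = F.NP7 x ∧
    -F.defect 1 2 3 0 x = F.NP8 x ∧
    -F.defect 1 2 3 2 x = F.NP9 x ∧
    -F.defect 1 2 0 1 x = F.NP13 x ∧
    -F.defect 1 2 0 2 x = F.NP14 x ∧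
    -F.defect 1 2 2 1 x = F.NP10 x := by
  obtain ⟨h01, h02, h21, h30, h31, h32⟩ := hF.comm_eq hx
  obtain ⟨r31, r30, r32, r01, r02, r21⟩ := hF.Rm_one_two hx
  refine ⟨?_, ?_, ?_, ?_, ?_, ?_⟩ <;>
    simp only [defect, hF.cartan_one_two hx, r31, r30, r32, r01, r02, r21,
      F.extDeriv_eq_of_comm_eq h01, F.extDeriv_eq_of_comm_eq h02, F.extDeriv_eq_of_comm_eq h21,
      F.extDeriv_eq_of_comm_eq h30, F.extDeriv_eq_of_comm_eq h31, F.extDeriv_eq_of_comm_eq h32,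
      spin11, spin01, Matrix.cons_val, NP7, NP8, NP9, NP10, NP13, NP14, D, Δ, δ, δb,
      Pi.sub_apply, Pi.add_apply, Pi.mul_apply, Pi.pow_apply, Pi.star_apply, Pi.ofNat_apply,
      Pi.neg_apply, Pi.div_apply] <;>
    ring

theorem half_defect_zero_one_sub (hU : IsOpen U) (hx : x ∈ U) :
    1 / 2 * (F.defect 0 1 3 1 x - F.defect 3 2 3 1 x) = F.NP4 x ∧
    1 / 2 * (F.defect 0 1 3 0 x - F.defect 3 2 3 0 x) = F.NP5 x ∧
    1 / 2 * (F.defect 0 1 3 2 x - F.defect 3 2 3 2 x) = F.NP6 x ∧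
    1 / 2 * (F.defect 0 1 0 1 x - F.defect 3 2 0 1 x) = F.NP12 x ∧
    1 / 2 * (F.defect 0 1 0 2 x - F.defect 3 2 0 2 x) = F.NP15 x ∧
    1 / 2 * (F.defect 0 1 2 1 x - F.defect 3 2 2 1 x) = F.NP18 x := by
  obtain ⟨h01, h02, h21, h30, h31, h32⟩ := hF.comm_eq hx
  obtain ⟨r31, r30, r32, r01, r02, r21⟩ := hF.half_Rm_three_two_sub hx
  have hdefect {c f r} (hr : 1 / 2 * (F.Rm 3 2 c f x - F.Rm 0 1 c f x) = r) :
      1 / 2 * (F.defect 0 1 c f x - F.defect 3 2 c f x) = F.extDeriv F.spin01 c f x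
        + (F.spin00 c x * F.spin11 f x - F.spin00 f x * F.spin11 c x) - r := by
    simp only [defect]
    linear_combination hF.half_cartan_three_two_sub hU hx c f - hr
  refine ⟨(hdefect r31).trans ?_, (hdefect r30).trans ?_, (hdefect r32).trans ?_,
      (hdefect r01).trans ?_, (hdefect r02).trans ?_, (hdefect r21).trans ?_⟩ <;>
    simp only [F.extDeriv_eq_of_comm_eq h01, F.extDeriv_eq_of_comm_eq h02,
      F.extDeriv_eq_of_comm_eq h21, F.extDeriv_eq_of_comm_eq h30, F.extDeriv_eq_of_comm_eq h31,
      F.extDeriv_eq_of_comm_eq h32, spin00, spin01, spin11, Matrix.cons_val, NP4, NP5, NP6, NP12,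
      NP15, NP18, D, Δ, δ, δb, Pi.sub_apply, Pi.add_apply, Pi.mul_apply, Pi.star_apply,
      Pi.ofNat_apply, Pi.div_apply] <;>
    ring

end IsAdmissibleOn

/-! ### Equivalence with the Cartan, Ricci and Jacobi equations -/

theorem eta_sum_cartan (F : Fields) (a b c f : Fin 4) (x : Coord) :
    ∑ h, eta a h * F.cartan h b c f x = F.d c (F.Γup a b f) x - F.d f (F.Γup a b c) x
      + ∑ h, (F.Γup h b f x * F.Γup a h c x - F.Γup h b c x * F.Γup a h f x
        - F.comm h c f x * F.Γup a b h x) := by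
  have hneg (h a b c : Fin 4) : F.d h (fun y => -F.Γ a b c y) x = -F.d h (F.Γ a b c) x :=
    dirDeriv_neg _ _ _
  rw [eta_sum]
  fin_cases a <;>
    simp only [cartan, Γup_zero, Γup_one, Γup_two, Γup_three, hneg, Fin.sum_univ_four,
      Fin.zero_eta, Fin.mk_one, Fin.reduceFinMk, Matrix.cons_val] <;>
    ring

theorem cov1_kComp (F : Fields) (a c : Fin 4) : F.cov1 kComp a c = F.Γup a 3 c := by
  have hd (y : Coord) : F.d c (kComp a) y = 0 := dirDeriv_const _ _ _
  funext y
  simp [cov1, hd, kComp]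

theorem ricciAt_iff_defect : F.RicciAt x ↔ ∀ a c f, F.defect a 3 c f x = 0 := by
  have hraise (a c f : Fin 4) :
      F.cov2 kComp a c f x - F.cov2 kComp a f c x
        - ∑ b, (∑ h, eta a h * F.Rm h b f c x) * kComp b x
      = -∑ h, eta a h * F.defect h 3 f c x := by
    have hk : ∑ b, (∑ h, eta a h * F.Rm h b f c x) * kComp b x
        = ∑ h, eta a h * F.Rm h 3 f c x := by
      simp [kComp]
    simp only [hk, defect, mul_sub, Finset.sum_sub_distrib, eta_sum_cartan, cov2, cov1_kComp]
    simp only [comm, Fin.sum_univ_four]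
    ring
  constructor
  · intro h a c f
    refine eta_sum_eq_zero_iff (f := (F.defect · 3 c f x)).mp (fun a => ?_) a
    rw [← neg_eq_zero, ← hraise, h a f c, sub_self]
  · intro h a c f
    rw [← sub_eq_zero, hraise, neg_eq_zero]
    exact eta_sum_eq_zero_iff.mpr (h · f c) a

namespace IsAdmissibleOn

variable (hF : F.IsAdmissibleOn U)
include hF

theorem d_comm (hU : IsOpen U) (hx : x ∈ U) (h a b c : Fin 4) :
    F.d h (F.comm a b c) x = F.d h (F.Γup a c b) x - F.d h (F.Γup a b c) x := by
  have hd (a b c : Fin 4) : DifferentiableAt ℝ (F.Γup a b c) x :=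
    DifferentiableAt.fun_sum fun h _ =>
      (differentiableAt_const _).mul (hF.conn_differentiableAt hU hx h b c)
  exact dirDeriv_sub (hd _ _ _) (hd _ _ _)

theorem jacobiAt_iff_defect (hU : IsOpen U) (hx : x ∈ U) :
    F.JacobiAt x ↔ ∀ a b c f, cyclicSum (fun a b c f => F.defect a b c f x) a b c f = 0 := by
  have hraise (a b c i : Fin 4) :
      (F.d a (F.comm i b c) x - ∑ h, F.comm i h a x * F.comm h b c x)
      + (F.d b (F.comm i c a) x - ∑ h, F.comm i h b x * F.comm h c a x)
      + (F.d c (F.comm i a b) x - ∑ h, F.comm i h c x * F.comm h a b x)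
      = -∑ h, eta i h * cyclicSum (fun a b c f => F.defect a b c f x) h a b c := by
    have hcyclic (h : Fin 4) : cyclicSum (fun a b c f => F.defect a b c f x) h a b c
        = -(F.cartan h a b c x + F.cartan h b c a x + F.cartan h c a b x) := by
      simp only [cyclicSum, defect]
      linear_combination hF.curv.cyclic x hx h a b c
    simp only [hcyclic, mul_neg, Finset.sum_neg_distrib, neg_neg, mul_add, Finset.sum_add_distrib,
      eta_sum_cartan, hF.d_comm hU hx]
    simp only [comm, Fin.sum_univ_four]
    ring
  simp only [JacobiAt, hraise, neg_eq_zero]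
  exact ⟨fun h a b c f => eta_sum_eq_zero_iff.mp (h b c f) a,
    fun h b c f => eta_sum_eq_zero_iff.mpr (h · b c f)⟩

theorem cartanAt_iff_allNPAt (hU : IsOpen U) (hx : x ∈ U) : F.CartanAt x ↔ F.AllNPAt x := by
  obtain ⟨n1, n2, n3, n11, n16, n17⟩ := hF.defect_zero_three hx
  obtain ⟨n7, n8, n9, n13, n14, n10⟩ := hF.neg_defect_one_two hx
  obtain ⟨n4, n5, n6, n12, n15, n18⟩ := hF.half_defect_zero_one_sub hU hx
  have hΩ := hF.isRealBiform_defect hU hx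
  rw [cartanAt_iff_defect]
  constructor
  · intro h
    simp [AllNPAt, ← n1, ← n2, ← n3, ← n4, ← n5, ← n6, ← n7, ← n8, ← n9, ← n10, ← n11, ← n12,
      ← n13, ← n14, ← n15, ← n16, ← n17, ← n18, h]
  · rintro ⟨h1, h2, h3, h4, h5, h6, h7, h8, h9, h10, h11, h12, h13, h14, h15, h16, h17, h18⟩
    have hdouble {z : ℂ} (hz : 1 / 2 * z = 0) : z = 0 := by simpa using hz
    refine hΩ.eq_zero_of_selfDual_eq_zero ?_ ?_ ?_
    · exact eq_zero_of_antisymm (hΩ.antisymm_right 0 3) (n11.trans h11) (n16.trans h16)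
        (n17.trans h17) (n2.trans h2) (n1.trans h1) (n3.trans h3)
    · exact eq_zero_of_antisymm (hΩ.antisymm_right 1 2) (neg_eq_zero.mp (n13.trans h13))
        (neg_eq_zero.mp (n14.trans h14)) (neg_eq_zero.mp (n10.trans h10))
        (neg_eq_zero.mp (n8.trans h8)) (neg_eq_zero.mp (n7.trans h7))
        (neg_eq_zero.mp (n9.trans h9))
    · refine eq_zero_of_antisymm (fun c f => ?_) (hdouble (n12.trans h12)) (hdouble (n15.trans h15))
        (hdouble (n18.trans h18)) (hdouble (n5.trans h5)) (hdouble (n4.trans h4))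
        (hdouble (n6.trans h6))
      rw [hΩ.antisymm_right 0 1, hΩ.antisymm_right 3 2, neg_sub_neg, neg_sub]

end IsAdmissibleOn

theorem allNPAt_iff : F.AllNPAt x ↔ F.JacobiNPAt x ∧ F.RicciNPAt x ∧ F.FieldNPAt x := by
  have hconj {z : ℂ} (hz : z = 0) : star z = 0 := by rw [hz, star_zero]
  simp only [AllNPAt, JacobiNPAt, RicciNPAt, FieldNPAt, Pi.sub_apply, Pi.add_apply, Pi.mul_apply,
    Pi.star_apply, Pi.ofNat_apply]
  constructor
  · intro h
    simp [h]
  · rintro ⟨⟨-, j2, -, j4, j5, j6, j7, j8, j9, j10⟩,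
      ⟨r1, r2, r3, r11, r16, r17, -, r15, r6, r12⟩, ⟨f10, f13, f12, f14⟩⟩
    have h8 : F.NP8 x = 0 := by linear_combination j6 - r17
    have h7 : F.NP7 x = 0 := star_eq_zero.mp (by linear_combination r16 - j5)
    have h4 : F.NP4 x = 0 := by linear_combination (1 / 2) * (j7 + hconj r3 + hconj r11)
    have h5 : F.NP5 x = 0 := by linear_combination (1 / 2) * (j8 + r3 - r11)
    have h6 : F.NP6 x = 0 := by linear_combination (1 / 2) * (r6 - j4 + h8 - hconj h8)
    have h12 : F.NP12 x = 0 := by linear_combination (1 / 2) * (f12 - r12)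
    have h14 : F.NP14 x = 0 := by linear_combination (1 / 2) * (f14 - j2)
    have hj10 := hconj j10
    simp only [star_add, star_sub, star_mul', star_ofNat] at hj10
    have h9 : F.NP9 x = 0 :=
      star_eq_zero.mp (by linear_combination r15 - (1 / 2) * j9 + (1 / 2) * hj10)
    have h15 : F.NP15 x = 0 := by linear_combination (1 / 2) * (j9 + hconj h9 + hconj f13)
    have h18 : F.NP18 x = 0 := by linear_combination (1 / 2) * (j10 - h9 + f13)
    exact ⟨r1, r2, r3, h4, h5, h6, h7, h8, h9, f10, r11, h12, f13, h14, h15, r16, r17, h18⟩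

namespace IsAdmissibleOn

variable (hF : F.IsAdmissibleOn U)
include hF

theorem defect_three_two (hU : IsOpen U) (hx : x ∈ U) :
    -F.defect 3 2 3 0 x = (star F.NP4 + F.NP5) x ∧
    -F.defect 3 2 0 2 x = (F.NP15 - star F.NP18) x ∧
    -F.defect 3 2 3 2 x = (star F.NP6 + F.NP6) x ∧
    F.defect 3 2 0 1 x = (star F.NP12 - F.NP12) x := by
  obtain ⟨n4, n5, n6, n12, n15, n18⟩ := hF.half_defect_zero_one_sub hU hx
  have hΩ := hF.isRealBiform_defect hU hx
  have hstar (c f : Fin 4) :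
      star (1 / 2 * (F.defect 0 1 c f x - F.defect 3 2 c f x)) =
        -(1 / 2) * (F.defect 0 1 (conjIdx c) (conjIdx f) x
          + F.defect 3 2 (conjIdx c) (conjIdx f) x) := by
    have h01 := hΩ.star_eq 0 1 c f
    have h32 := hΩ.star_eq 3 2 c f
    rw [conjIdx_zero, conjIdx_one, hΩ.antisymm_left 1 0] at h01
    simp only [star_mul', star_sub, star_div₀, star_one, star_ofNat, h01, h32, conjIdx_two,
      conjIdx_three]
    ring
  simp only [Pi.add_apply, Pi.sub_apply, Pi.star_apply, ← n4, ← n5, ← n6, ← n12, ← n15, ← n18,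
    hstar, conjIdx_zero, conjIdx_one, conjIdx_two, conjIdx_three]
  refine ⟨by ring, ?_, by ring, ?_⟩
  · linear_combination (-1 / 2) * (hΩ.antisymm_right 0 1 2 0 + hΩ.antisymm_right 3 2 2 0)
  · linear_combination (1 / 2) * (hΩ.antisymm_right 0 1 1 0 + hΩ.antisymm_right 3 2 1 0)

theorem ricciAt_iff_ricciNPAt (hU : IsOpen U) (hx : x ∈ U) : F.RicciAt x ↔ F.RicciNPAt x := by
  obtain ⟨n1, n2, n3, n11, n16, n17⟩ := hF.defect_zero_three hx
  obtain ⟨n45, n1518, n66, n1212⟩ := hF.defect_three_two hU hx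
  have hΩ := hF.isRealBiform_defect hU hx
  rw [ricciAt_iff_defect, RicciNPAt, ← n1, ← n2, ← n3, ← n11, ← n16, ← n17, ← n45, ← n1518, ← n66,
    ← n1212]
  constructor
  · intro h
    have h32 (c f : Fin 4) : F.defect 3 2 c f x = 0 := by
      rw [hΩ.antisymm_left 3 2, h, neg_zero]
    simp [h, h32]
  · rintro ⟨h31, h30, h32, h01, h02, h21, h3230, h3202, h3232, h3201⟩
    exact hΩ.right_three_eq_zero
      (eq_zero_of_antisymm (hΩ.antisymm_right 0 3) h01 h02 h21 h30 h31 h32)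
      h3201 (neg_eq_zero.mp h3202) (neg_eq_zero.mp h3230) (neg_eq_zero.mp h3232)

theorem cyclicSum_defect (hU : IsOpen U) (hx : x ∈ U) {T : Fin 4 → Fin 4 → Fin 4 → Fin 4 → ℂ}
    (hT : T = cyclicSum fun a b c f => F.defect a b c f x) :
    T 3 0 1 3 = F.NP1 x - star (F.NP1 x) ∧
    T 2 0 1 2 = star (F.NP14 x) - F.NP14 x ∧
    T 2 0 1 3 = F.NP12 x + F.NP8 x - star (F.NP12 x) - star (F.NP8 x) ∧
    T 0 1 2 3 = star (F.NP6 x) - F.NP6 x - star (F.NP8 x) - F.NP17 x ∧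
    T 3 0 1 2 = F.NP17 x - star (F.NP17 x) + star (F.NP12 x) - F.NP12 x ∧
    T 0 0 2 3 = F.NP16 x - star (F.NP7 x) ∧
    T 0 0 1 3 = F.NP5 x - star (F.NP4 x) + F.NP11 x ∧
    T 3 0 2 3 = F.NP3 x - F.NP5 x - star (F.NP4 x) ∧
    T 0 0 1 2 = -(F.NP15 x - star (F.NP13 x) + star (F.NP18 x)) ∧
    T 2 0 2 3 = F.NP15 x - star (F.NP9 x) - star (F.NP18 x) := by
  obtain ⟨n1, -, n3, n11, n16, n17⟩ := hF.defect_zero_three hx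
  obtain ⟨n7, n8, n9, n13, n14, -⟩ := hF.neg_defect_one_two hx
  obtain ⟨n4, n5, n6, n12, n15, n18⟩ := hF.half_defect_zero_one_sub hU hx
  have hΩ := hF.isRealBiform_defect hU hx
  have hleft := hΩ.antisymm_left
  have hright := hΩ.antisymm_right
  have hstar := hΩ.star_eq
  subst hT
  simp only [cyclicSum, ← n1, ← n3, ← n4, ← n5,
    ← n6, ← n7, ← n8, ← n9, ← n11, ← n12, ← n13, ← n14, ← n15, ← n16, ← n17, ← n18,
    star_neg, star_mul', star_sub, star_div₀, star_one, star_ofNat, hstar, conjIdx_zero,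
    conjIdx_one, conjIdx_two, conjIdx_three]
  refine ⟨?_, ?_, ?_, ?_, ?_, ?_, ?_, ?_, ?_, ?_⟩ <;> grind

theorem jacobiAt_iff_jacobiNPAt (hU : IsOpen U) (hx : x ∈ U) : F.JacobiAt x ↔ F.JacobiNPAt x := by
  set T := cyclicSum fun a b c f => F.defect a b c f x with hT
  obtain ⟨t3013, t2012, t2013, t0123, t3012, t0023, t0013, t3023, t0012, t2023⟩ :=
    hF.cyclicSum_defect hU hx hT
  rw [hF.jacobiAt_iff_defect hU hx, ← hT]
  simp only [JacobiNPAt, Pi.add_apply, Pi.sub_apply, Pi.star_apply, Pi.mul_apply, Pi.ofNat_apply]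
  constructor
  · intro h
    simp only [h] at t3013 t2012 t2013 t0123 t3012 t0023 t0013 t3023 t0012 t2023
    have s0123 := congrArg star t0123
    have s0013 := congrArg star t0013
    have s3023 := congrArg star t3023
    have s0012 := congrArg star t0012
    have s2023 := congrArg star t2023
    simp only [star_zero, star_neg, star_sub, star_add, star_star] at s0123 s0013 s3023 s0012 s2023
    refine ⟨?_, ?_, ?_, ?_, ?_, ?_, ?_, ?_, ?_, ?_⟩ <;> grind
  · rintro ⟨j1, j2, j3, j4, j5, j6, j7, j8, j9, j10⟩
    have s6 := congrArg star j6
    have s7 := congrArg star j7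
    have s10 := congrArg star j10
    simp only [star_zero, star_sub, star_add, star_mul', star_ofNat, star_star] at s6 s7 s10
    refine (hF.isRealBiform_defect hU hx).cyclicSum_eq_zero ?_ ?_ ?_ ?_ ?_ ?_ ?_ ?_ ?_ ?_ <;> grind

end IsAdmissibleOn

end Fields

/-! ### A model with prescribed values of the field equations -/

section Model

open Complex

/-- The connection coefficients `Γ_{abc}` with spin connection forms `spin00 = A`, `spin01 = B`,
`spin11 = C`. -/
def connOfSpin (A B C : Fin 4 → Scalar) (a b c : Fin 4) : Scalar := fun y =>
  let A' := star (A (conjIdx c) y)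
  let B' := star (B (conjIdx c) y)
  let C' := star (C (conjIdx c) y)
  (!![0, B' - B c y, C', -A c y;
      B c y - B', 0, C c y, -A';
      -C', -C c y, 0, -(B c y + B');
      A c y, A', B c y + B', 0] : Matrix (Fin 4) (Fin 4) ℂ) a b

section

variable {U : Set Coord} {A B C : Fin 4 → Scalar} {t : Tetrad}
  {Rm : Fin 4 → Fin 4 → Fin 4 → Fin 4 → Scalar}

theorem contDiffOn_connOfSpin (hA : ∀ c, ContDiffOn ℝ ∞ (A c) U)
    (hB : ∀ c, ContDiffOn ℝ ∞ (B c) U) (hC : ∀ c, ContDiffOn ℝ ∞ (C c) U) (a b c : Fin 4) :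
    ContDiffOn ℝ ∞ (connOfSpin A B C a b c) U := by
  have hstar {f : Scalar} (hf : ContDiffOn ℝ ∞ f U) : ContDiffOn ℝ ∞ (fun y => star (f y)) U :=
    conjCLE.contDiff.comp_contDiffOn hf
  have hA' := hstar (hA (conjIdx c))
  have hB' := hstar (hB (conjIdx c))
  have hC' := hstar (hC (conjIdx c))
  fin_cases a <;> fin_cases b <;>
    first
    | exact contDiffOn_const
    | exact hA c
    | exact (hA c).neg
    | exact hA'
    | exact hA'.neg
    | exact hB'.sub (hB c)
    | exact (hB c).sub hB'
    | exact (hB c).add hB'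
    | exact ((hB c).add hB').neg
    | exact hC c
    | exact (hC c).neg
    | exact hC'
    | exact hC'.neg

theorem isAdmissibleOn_connOfSpin (ht : t.SmoothOn U) (hRm : IsCurvatureFieldOn U Rm)
    (hA : ∀ c, ContDiffOn ℝ ∞ (A c) U) (hB : ∀ c, ContDiffOn ℝ ∞ (B c) U)
    (hC : ∀ c, ContDiffOn ℝ ∞ (C c) U) :
    Fields.IsAdmissibleOn ⟨t, connOfSpin A B C, Rm⟩ U where
  tetrad_smooth := ht
  conn_smooth := contDiffOn_connOfSpin hA hB hC
  conn_antisymm y _ a b c := by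
    fin_cases a <;> fin_cases b <;> simp [connOfSpin]
  conn_real y _ a b c := by
    fin_cases a <;> fin_cases b <;> simp [connOfSpin, conjIdx_conjIdx, add_comm]
  curv := hRm

theorem spin_connOfSpin (t : Tetrad) (A B C : Fin 4 → Scalar)
    (Rm : Fin 4 → Fin 4 → Fin 4 → Fin 4 → Scalar) :
    Fields.spin00 ⟨t, connOfSpin A B C, Rm⟩ = A ∧ Fields.spin01 ⟨t, connOfSpin A B C, Rm⟩ = B ∧
      Fields.spin11 ⟨t, connOfSpin A B C, Rm⟩ = C := by
  refine ⟨?_, ?_, ?_⟩ <;> funext c y <;> fin_cases c <;>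
    simp only [Fields.spin00, Fields.spin01, Fields.spin11, Fields.κ, Fields.ρ, Fields.σ, Fields.τ,
      Fields.μ, Fields.π, Fields.ε, Fields.β, Fields.ν, Fields.lam, Fields.α, Fields.γ, connOfSpin,
      Fin.zero_eta, Fin.mk_one, Fin.reduceFinMk, Matrix.cons_val, Matrix.of_apply,
      Pi.neg_apply] <;>
    ring

end

theorem dirDeriv_coord (v : VecField) (i : Fin 4) (x : Coord) :
    dirDeriv v (fun y => (y i : ℂ)) x = v x i := by
  have hi (j : Fin 4) : fderiv ℝ (fun y : Coord => y i) x (Pi.single j 1)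
      = (Pi.single j 1 : Coord) i := by
    rw [(hasFDerivAt_apply (𝕜 := ℝ) i x).fderiv]
    rfl
  simp [dirDeriv, fderiv_ofReal_apply (differentiableAt_apply i x), hi, Pi.single_apply, apply_ite]

/-- The complex-valued linear function with derivative `p` along `ℓ`, and `q`, `r` along `m`, `m̄`
in the tetrad `modelTetrad` at the origin. -/
def linearScalar (p q r : ℂ) : Scalar := fun y =>
  p * y 2 + (q + r) / 2 * y 0 + (r - q) * I / 2 * y 1

theorem contDiff_linearScalar (p q r : ℂ) : ContDiff ℝ ∞ (linearScalar p q r) := by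
  have h (i : Fin 4) : ContDiff ℝ ∞ (fun y : Coord => (y i : ℂ)) :=
    ofRealCLM.contDiff.comp (contDiff_apply ℝ ℝ i)
  exact ((contDiff_const.mul (h 2)).add (contDiff_const.mul (h 0))).add (contDiff_const.mul (h 1))

theorem linearScalar_zero_apply (p q r : ℂ) : linearScalar p q r 0 = 0 := by
  simp [linearScalar]

theorem dirDeriv_linearScalar (v : VecField) (p q r : ℂ) (x : Coord) :
    dirDeriv v (linearScalar p q r) x
      = p * v x 2 + (q + r) / 2 * v x 0 + (r - q) * I / 2 * v x 1 := by
  have h (i : Fin 4) : DifferentiableAt ℝ (fun y : Coord => (y i : ℂ)) x :=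
    ofRealCLM.differentiableAt.comp x (differentiableAt_apply i x)
  have h' (z : ℂ) (i : Fin 4) : DifferentiableAt ℝ (fun y : Coord => z * (y i : ℂ)) x :=
    (h i).const_mul z
  unfold linearScalar
  rw [dirDeriv_add ((h' _ _).fun_add (h' _ _)) (h' _ _), dirDeriv_add (h' _ _) (h' _ _),
    dirDeriv_const_mul _ (h _), dirDeriv_const_mul _ (h _), dirDeriv_const_mul _ (h _),
    dirDeriv_coord, dirDeriv_coord, dirDeriv_coord]

/-- A tetrad whose only nonzero commutators are `[k, m] = [k, m̄] = -ℓ`. -/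
def modelTetrad : Tetrad where
  m := fun y => ![1, I, -y 3, 0]
  l := fun _ => ![0, 0, 1, 0]
  k := fun _ => ![0, 0, 0, 1]

/-- The variables with `NP10 = a`, `NP13 = b`, `NP12 = c / 2`, `NP14 = d / 2` at the origin: all
spin coefficients but `κ = 1` vanish there, and only the first derivatives of the linear functions
`α`, `γ`, `λ`, `ν` contribute. The terms with `b` in `α` and `γ` balance `NP13` in the Jacobi
equations. -/
def modelFields (a b : ℂ) (c d : ℝ) : Fields where
  t := modelTetrad
  Γ := connOfSpin ![0, 0, 0, 1]
    ![0, linearScalar (b / 2) (c / 2) 0, linearScalar 0 (star b / 2) 0, 0]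
    ![0, linearScalar a b 0, linearScalar 0 (d / 2) 0, 0]
  Rm := 0

theorem smoothOn_modelTetrad : modelTetrad.SmoothOn Set.univ := by
  refine ⟨contDiffOn_pi.mpr fun i => ?_, contDiffOn_const, contDiffOn_const⟩
  have h3 := (contDiffOn_ofReal (U := Set.univ)
    (contDiff_apply ℝ ℝ (3 : Fin 4)).contDiffOn).neg
  fin_cases i <;> first | exact contDiffOn_const | exact h3

theorem linearIndependent_modelTetrad :
    LinearIndependent ℂ (fun i => modelTetrad.e i (0 : Coord)) := by
  rw [Fintype.linearIndependent_iff]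
  intro g hg
  have hcoord (i : Fin 4) := congrFun hg i
  simp only [Tetrad.e, modelTetrad, Finset.sum_apply, Fin.sum_univ_four, Pi.smul_apply] at hcoord
  have h0 : g 0 + g 1 = 0 := by simpa using hcoord 0
  have h1 : g 0 * I - g 1 * I = 0 := by simpa [sub_eq_add_neg] using hcoord 1
  have h1' : g 0 - g 1 = 0 := by linear_combination -I * h1 + (g 0 - g 1) * I_mul_I
  intro i
  fin_cases i
  · exact show g 0 = 0 by linear_combination (1 / 2) * (h0 + h1')
  · exact show g 1 = 0 by linear_combination (1 / 2) * (h0 - h1')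
  · simpa using hcoord 2
  · simpa using hcoord 3

theorem dirDeriv_modelTetrad_linearScalar (i : Fin 4) (p q r : ℂ) :
    dirDeriv (modelTetrad.e i) (linearScalar p q r) 0 = ![q, r, p, 0] i := by
  rw [dirDeriv_linearScalar]
  fin_cases i <;> simp [modelTetrad, Tetrad.e] <;> grind [I_sq]

section

variable (a b : ℂ) (c d : ℝ)

theorem isAdmissibleOn_modelFields : (modelFields a b c d).IsAdmissibleOn Set.univ := by
  have hcurv : IsCurvatureFieldOn Set.univ (0 : Fin 4 → Fin 4 → Fin 4 → Fin 4 → Scalar) := by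
    constructor <;> intros <;> simp [contDiffOn_const, Pi.zero_def]
  have hlin (p q r : ℂ) := (contDiff_linearScalar p q r).contDiffOn (s := Set.univ)
  refine isAdmissibleOn_connOfSpin smoothOn_modelTetrad hcurv ?_ ?_ ?_ <;>
    exact fun e => by fin_cases e <;> first | exact hlin _ _ _ | exact contDiffOn_const

theorem spin_modelFields :
    (modelFields a b c d).spin00 = ![0, 0, 0, 1] ∧
    (modelFields a b c d).spin01
      = ![0, linearScalar (b / 2) (c / 2) 0, linearScalar 0 (star b / 2) 0, 0] ∧
    (modelFields a b c d).spin11 = ![0, linearScalar a b 0, linearScalar 0 (d / 2) 0, 0] :=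
  spin_connOfSpin _ _ _ _ _

theorem curvature_modelFields :
    (modelFields a b c d).R = 0 ∧ (∀ i j, (modelFields a b c d).Ric i j = 0) ∧
    ∀ i j h l, (modelFields a b c d).Weyl i j h l = 0 := by
  refine ⟨?_, fun i j => ?_, fun i j h l => ?_⟩ <;> funext y <;>
    simp [Fields.Weyl, Fields.R, Fields.Ric, modelFields]

theorem bianchiAt_modelFields (x : Coord) : (modelFields a b c d).BianchiAt x := by
  intro i j h l s
  simp [Fields.covRm, modelFields, Fields.d, dirDeriv]

theorem commutatorsAt_modelFields : (modelFields a b c d).CommutatorsAt 0 := by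
  have hd (i j h) : (modelFields a b c d).d i (fun y => modelTetrad.e j y h) 0
      = if i = 3 ∧ h = 2 ∧ (j = 0 ∨ j = 1) then -1 else 0 := by
    fin_cases i <;> fin_cases j <;> fin_cases h <;>
      simp [Fields.d, modelFields, modelTetrad, Tetrad.e, dirDeriv_neg, dirDeriv_coord,
        dirDeriv_const]
  intro i j h
  have ht : (modelFields a b c d).t = modelTetrad := rfl
  rw [ht, hd, hd]
  simp only [Fields.comm, Fields.Γup_zero, Fields.Γup_one, Fields.Γup_two, Fields.Γup_three,
    Fin.sum_univ_four]
  fin_cases h <;> fin_cases i <;> fin_cases j <;>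
    simp [modelFields, connOfSpin, modelTetrad, Tetrad.e, linearScalar_zero_apply]

theorem np_modelFields : let F := modelFields a b c d
    (F.NP1 0 = 0 ∧ F.NP2 0 = 0 ∧ F.NP3 0 = 0 ∧ F.NP4 0 = 0 ∧ F.NP5 0 = 0 ∧ F.NP6 0 = 0) ∧
    (F.NP7 0 = 0 ∧ F.NP8 0 = 0 ∧ F.NP9 0 = 0 ∧ F.NP10 0 = a ∧ F.NP11 0 = 0 ∧ F.NP12 0 = c / 2) ∧
    F.NP13 0 = b ∧ F.NP14 0 = d / 2 ∧ F.NP15 0 = star b / 2 ∧ F.NP16 0 = 0 ∧ F.NP17 0 = 0 ∧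
    F.NP18 0 = b / 2 := by
  intro F
  obtain ⟨hA, hB, hC⟩ := spin_modelFields a b c d
  obtain ⟨hR, hRic, hW⟩ := curvature_modelFields a b c d
  have hκ : F.κ = 1 := congrFun hA 3
  have hρ : F.ρ = 0 := congrFun hA 1
  have hσ : F.σ = 0 := congrFun hA 0
  have hτ : F.τ = 0 := congrFun hA 2
  have hμ : F.μ = 0 := congrFun hC 0
  have hπ : F.π = 0 := congrFun hC 3
  have hε : F.ε = 0 := congrFun hB 3
  have hβ : F.β = 0 := congrFun hB 0
  have hν : F.ν = linearScalar 0 (d / 2) 0 := congrFun hC 2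
  have hlam : F.lam = linearScalar a b 0 := congrFun hC 1
  have hα : F.α = linearScalar (b / 2) (c / 2) 0 := congrFun hB 1
  have hγ : F.γ = linearScalar 0 (star b / 2) 0 := congrFun hB 2
  have hd0 (i) : F.d i 0 0 = 0 := dirDeriv_const _ 0 0
  have hd1 (i) : F.d i 1 0 = 0 := dirDeriv_const _ 1 0
  have hd (i p q r) : F.d i (linearScalar p q r) 0 = ![q, r, p, 0] i :=
    dirDeriv_modelTetrad_linearScalar i p q r
  refine ⟨⟨?_, ?_, ?_, ?_, ?_, ?_⟩, ⟨?_, ?_, ?_, ?_, ?_, ?_⟩, ?_, ?_, ?_, ?_, ?_, ?_⟩ <;>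
    simp [Fields.NP1, Fields.NP2, Fields.NP3, Fields.NP4, Fields.NP5, Fields.NP6, Fields.NP7,
      Fields.NP8, Fields.NP9, Fields.NP10, Fields.NP11, Fields.NP12, Fields.NP13, Fields.NP14,
      Fields.NP15, Fields.NP16, Fields.NP17, Fields.NP18, Fields.D, Fields.Δ, Fields.δ,
      Fields.δb, Fields.Ψ0, Fields.Ψ1, Fields.Ψ2, Fields.Ψ3, Fields.Ψ4, Fields.Φ00, Fields.Φ01,
      Fields.Φ10, Fields.Φ02, Fields.Φ20, Fields.Φ11, Fields.Φ12, Fields.Φ21, Fields.Φ22,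
      hR, hRic, hW, hκ, hρ, hσ, hτ, hμ, hπ, hε, hβ, hν, hlam, hα, hγ, hd, hd0, hd1,
      linearScalar_zero_apply, -star_def, F]

end

theorem exists_isAdmissibleOn_fieldNP (a b : ℂ) (c d : ℝ) : ∃ (F : Fields) (x : Coord),
    F.IsAdmissibleOn Set.univ ∧ LinearIndependent ℂ (fun i => F.t.e i x) ∧ F.κ x ≠ 0 ∧
    F.CommutatorsAt x ∧ F.JacobiNPAt x ∧ F.RicciNPAt x ∧ F.BianchiAt x ∧
    F.NP10 x = a ∧ F.NP13 x = b ∧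
    (F.NP12 + star F.NP12) x = c ∧ (F.NP14 + star F.NP14) x = d := by
  obtain ⟨⟨n1, n2, n3, n4, n5, n6⟩, ⟨n7, n8, n9, n10, n11, n12⟩, n13, n14, n15, n16, n17, n18⟩ :=
    np_modelFields a b c d
  have hκ : (modelFields a b c d).κ 0 = 1 := congrFun (congrFun (spin_modelFields a b c d).1 3) 0
  refine ⟨modelFields a b c d, 0, isAdmissibleOn_modelFields a b c d,
    linearIndependent_modelTetrad, by simp [hκ], commutatorsAt_modelFields a b c d, ?_, ?_,
    bianchiAt_modelFields a b c d 0, n10, n13, by simp [n12], by simp [n14]⟩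
  · simp [Fields.JacobiNPAt, n1, n3, n4, n5, n6, n7, n8, n9, n11, n12, n13, n14, n15, n16, n17, n18,
      mul_div_cancel₀]
  · simp [Fields.RicciNPAt, n1, n2, n3, n11, n16, n17, n4, n5, n15, n18, n6, n12]

end Model

/-! ### The Levi-Civita connection -/

section Metric

variable {g : Coord → Matrix (Fin 4) (Fin 4) ℝ} {x : Coord}

theorem star_metricInner (g : Coord → Matrix (Fin 4) (Fin 4) ℝ) (V W : VecField) (x : Coord) :
    star (metricInner g V W x)
      = metricInner g (fun y i => star (V y i)) (fun y i => star (W y i)) x := by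
  simp [metricInner]

theorem star_covDeriv (g : Coord → Matrix (Fin 4) (Fin 4) ℝ) (V W : VecField) (x : Coord)
    (i : Fin 4) : star (covDeriv g V W x i)
      = covDeriv g (fun y i => star (V y i)) (fun y i => star (W y i)) x i := by
  simp only [covDeriv, star_add, dirDeriv_star, star_sum, star_mul', Complex.star_def,
    Complex.conj_ofReal]

theorem metricInner_comm (hsymm : (g x).IsSymm) (V W : VecField) :
    metricInner g V W x = metricInner g W V x := by
  simp only [metricInner]
  rw [Finset.sum_comm]
  refine Finset.sum_congr rfl fun j _ => Finset.sum_congr rfl fun k _ => ?_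
  rw [hsymm.apply j k]
  ring

theorem fderiv_metric_comm (hsymm : ∀ᶠ y in 𝓝 x, (g y).IsSymm) (i j : Fin 4) :
    fderiv ℝ (fun y => g y i j) x = fderiv ℝ (fun y => g y j i) x :=
  EventuallyEq.fderiv_eq (hsymm.mono fun _ hy => hy.apply j i)

theorem christoffel_comm (hsymm : ∀ᶠ y in 𝓝 x, (g y).IsSymm) (i j k : Fin 4) :
    christoffel g i j k x = christoffel g i k j x := by
  simp only [christoffel, fderiv_metric_comm hsymm j k]
  congr 1
  exact Finset.sum_congr rfl fun _ _ => by ring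

theorem sum_metric_mul_christoffel (hdet : IsUnit (g x).det) (i j k : Fin 4) :
    ∑ m, g x i m * christoffel g m j k x
      = (1 / 2) * (fderiv ℝ (fun y => g y i k) x (Pi.single j 1)
      + fderiv ℝ (fun y => g y i j) x (Pi.single k 1)
      - fderiv ℝ (fun y => g y j k) x (Pi.single i 1)) := by
  set A : Fin 4 → ℝ := fun l => fderiv ℝ (fun y => g y l k) x (Pi.single j 1)
      + fderiv ℝ (fun y => g y l j) x (Pi.single k 1)
      - fderiv ℝ (fun y => g y j k) x (Pi.single l 1)
  have hchristoffel : (christoffel g · j k x) = (1 / 2 : ℝ) • ((g x)⁻¹.mulVec A) := rfl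
  calc ∑ m, g x i m * christoffel g m j k x
      = (g x).mulVec ((1 / 2 : ℝ) • ((g x)⁻¹.mulVec A)) i := by rw [← hchristoffel]; rfl
    _ = (1 / 2) * A i := by
        rw [Matrix.mulVec_smul, Matrix.mulVec_mulVec, Matrix.mul_nonsing_inv _ hdet,
          Matrix.one_mulVec, Pi.smul_apply, smul_eq_mul]

theorem fderiv_metric (hsymm : ∀ᶠ y in 𝓝 x, (g y).IsSymm) (hdet : IsUnit (g x).det)
    (i j k : Fin 4) : fderiv ℝ (fun y => g y i j) x (Pi.single k 1)
      = ∑ m, (g x j m * christoffel g m k i x + g x i m * christoffel g m k j x) := by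
  rw [Finset.sum_add_distrib, sum_metric_mul_christoffel hdet, sum_metric_mul_christoffel hdet,
    fderiv_metric_comm hsymm j i, fderiv_metric_comm hsymm j k, fderiv_metric_comm hsymm i k]
  ring

theorem dirDeriv_metric (hg : ∀ i j, DifferentiableAt ℝ (fun y => g y i j) x)
    (hsymm : ∀ᶠ y in 𝓝 x, (g y).IsSymm) (hdet : IsUnit (g x).det) (V : VecField) (i j : Fin 4) :
    dirDeriv V (fun y => (g y i j : ℂ)) x
      = ∑ m, ((g x m j : ℂ) * ∑ k, (christoffel g m k i x : ℂ) * V x k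
        + (g x i m : ℂ) * ∑ k, (christoffel g m k j x : ℂ) * V x k) := by
  simp only [dirDeriv, fderiv_ofReal_apply (hg i j), fderiv_metric hsymm hdet,
    hsymm.self_of_nhds.apply _ j, Complex.ofReal_add, Complex.ofReal_mul,
    Fin.sum_univ_four]
  ring

theorem dirDeriv_metricInner (hg : ∀ i j, DifferentiableAt ℝ (fun y => (g y i j : ℂ)) x)
    {W₁ W₂ : VecField} (h₁ : ∀ i, DifferentiableAt ℝ (fun y => W₁ y i) x)
    (h₂ : ∀ i, DifferentiableAt ℝ (fun y => W₂ y i) x) (V : VecField) :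
    dirDeriv V (metricInner g W₁ W₂) x = ∑ i, ∑ j,
      (dirDeriv V (fun y => (g y i j : ℂ)) x * W₁ x i * W₂ x j
        + g x i j * dirDeriv V (fun y => W₁ y i) x * W₂ x j
        + g x i j * W₁ x i * dirDeriv V (fun y => W₂ y j) x) := by
  have hterm (i j) := ((hg i j).fun_mul (h₁ i)).fun_mul (h₂ j)
  unfold metricInner
  rw [dirDeriv_sum fun i _ => DifferentiableAt.fun_sum fun j _ => hterm i j]
  refine Finset.sum_congr rfl fun i _ => ?_
  rw [dirDeriv_sum fun j _ => hterm i j]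
  refine Finset.sum_congr rfl fun j _ => ?_
  rw [dirDeriv_mul ((hg i j).fun_mul (h₁ i)) (h₂ j), dirDeriv_mul (hg i j) (h₁ i)]
  ring

theorem dirDeriv_metricInner_eq_covDeriv (hg : ∀ i j, DifferentiableAt ℝ (fun y => g y i j) x)
    (hsymm : ∀ᶠ y in 𝓝 x, (g y).IsSymm) (hdet : IsUnit (g x).det) {W₁ W₂ : VecField}
    (h₁ : ∀ i, DifferentiableAt ℝ (fun y => W₁ y i) x)
    (h₂ : ∀ i, DifferentiableAt ℝ (fun y => W₂ y i) x) (V : VecField) :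
    dirDeriv V (metricInner g W₁ W₂) x
      = metricInner g (covDeriv g V W₁) W₂ x + metricInner g W₁ (covDeriv g V W₂) x := by
  have hgC (i j) : DifferentiableAt ℝ (fun y => (g y i j : ℂ)) x :=
    Complex.ofRealCLM.differentiableAt.comp x (hg i j)
  obtain ⟨N, hN⟩ : ∃ N : Fin 4 → Fin 4 → ℂ,
      ∀ i k, ∑ j, (christoffel g i j k x : ℂ) * V x j = N i k := ⟨_, fun _ _ => rfl⟩
  have hcov (W : VecField) (i) :
      covDeriv g V W x i = dirDeriv V (fun y => W y i) x + ∑ k, N i k * W x k := by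
    simp only [covDeriv, ← hN, Finset.sum_mul]
    rw [Finset.sum_comm]
  rw [dirDeriv_metricInner hgC h₁ h₂]
  simp only [dirDeriv_metric hg hsymm hdet, metricInner, hcov, hN, Fin.sum_univ_four]
  ring

theorem covDeriv_sub_covDeriv (hsymm : ∀ᶠ y in 𝓝 x, (g y).IsSymm) (V W : VecField) (i : Fin 4) :
    covDeriv g V W x i - covDeriv g W V x i
      = dirDeriv V (fun y => W y i) x - dirDeriv W (fun y => V y i) x := by
  have h : ∑ j, ∑ k, (christoffel g i j k x : ℂ) * V x j * W x k
      = ∑ j, ∑ k, (christoffel g i j k x : ℂ) * W x j * V x k := by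
    rw [Finset.sum_comm]
    refine Finset.sum_congr rfl fun j _ => Finset.sum_congr rfl fun k _ => ?_
    rw [christoffel_comm hsymm]
    ring
  simp only [covDeriv, h]
  ring

end Metric

/-! ### Null tetrads of a metric -/

theorem Tetrad.SmoothOn.e {t : Tetrad} {U : Set Coord} (ht : t.SmoothOn U) (a i : Fin 4) :
    ContDiffOn ℝ ∞ (fun x => t.e a x i) U := by
  obtain ⟨hm, hl, hk⟩ := ht
  have hm' := contDiffOn_pi.mp hm i
  fin_cases a
  · exact hm'
  · exact Complex.conjCLE.contDiff.comp_contDiffOn hm'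
  · exact contDiffOn_ofReal (contDiffOn_pi.mp hl i)
  · exact contDiffOn_ofReal (contDiffOn_pi.mp hk i)

namespace IsNullTetradOn

variable {U : Set Coord} {g : Coord → Matrix (Fin 4) (Fin 4) ℝ} {t : Tetrad} {x : Coord}
  (hN : IsNullTetradOn U g t)
include hN

theorem frame_mul_metric (hx : x ∈ U) :
    (Matrix.of fun i a => t.e a x i) * eta * (Matrix.of fun i a => t.e a x i).transpose
      * (g x).map Complex.ofReal = 1 := by
  set M : Matrix (Fin 4) (Fin 4) ℂ := Matrix.of fun i a => t.e a x i with hM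
  have h : M.transpose * (g x).map Complex.ofReal * M = eta := by
    ext a b
    rw [← hN.inner_eq x hx a b]
    simp only [Matrix.mul_apply, Matrix.transpose_apply, Matrix.map_apply, hM, Matrix.of_apply,
      metricInner, Finset.sum_mul]
    rw [Finset.sum_comm]
    exact Finset.sum_congr rfl fun _ _ => Finset.sum_congr rfl fun _ _ => by ring
  have h' : (eta * M.transpose * (g x).map Complex.ofReal) * M = 1 := by
    rw [Matrix.mul_assoc, Matrix.mul_assoc, ← Matrix.mul_assoc M.transpose, h, eta_mul_eta]
  rw [mul_eq_one_comm] at h'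
  rw [← h']
  simp only [Matrix.mul_assoc]

theorem sum_eta_mul_metricInner (hx : x ∈ U) (V : VecField) (i : Fin 4) :
    ∑ a, (∑ b, eta a b * metricInner g (t.e b) V x) * t.e a x i = V x i := by
  have h := congrFun (congrArg (fun A => Matrix.mulVec A (V x)) (hN.frame_mul_metric hx)) i
  simp only [Matrix.one_mulVec] at h
  rw [← h]
  simp only [metricInner, Matrix.mulVec, dotProduct, Matrix.mul_apply, Matrix.transpose_apply,
    Matrix.map_apply, Matrix.of_apply, Fin.sum_univ_four]
  ring

theorem isUnit_det_metric (hx : x ∈ U) : IsUnit (g x).det := by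
  have h : IsUnit ((g x).map Complex.ofReal).det :=
    Matrix.isUnit_det_of_left_inverse (hN.frame_mul_metric hx)
  have hdet : ((g x).map Complex.ofReal).det = ((g x).det : ℂ) :=
    (RingHom.map_det Complex.ofRealHom (g x)).symm
  rw [hdet, isUnit_iff_ne_zero] at h
  exact isUnit_iff_ne_zero.mpr (by exact_mod_cast h)

theorem inv_metric_apply (hx : x ∈ U) (i j : Fin 4) :
    (((g x)⁻¹ i j : ℝ) : ℂ) = ∑ a, ∑ b, eta a b * t.e a x i * t.e b x j := by
  have hmul : (g x).map Complex.ofReal * (g x)⁻¹.map Complex.ofReal = 1 := by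
    change (g x).map Complex.ofRealHom * (g x)⁻¹.map Complex.ofRealHom = 1
    rw [← Matrix.map_mul, Matrix.mul_nonsing_inv _ (hN.isUnit_det_metric hx),
      Matrix.map_one _ (map_zero _) (map_one _)]
  have hinv : (Matrix.of fun i a => t.e a x i) * eta * (Matrix.of fun i a => t.e a x i).transpose
      = (g x)⁻¹.map Complex.ofReal := left_inv_eq_right_inv (hN.frame_mul_metric hx) hmul
  rw [← Matrix.map_apply (f := Complex.ofReal), ← hinv]
  simp only [Matrix.mul_apply, Matrix.transpose_apply, Matrix.of_apply, Finset.sum_mul]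
  rw [Finset.sum_comm]
  exact Finset.sum_congr rfl fun _ _ => Finset.sum_congr rfl fun _ _ => by ring

theorem contDiffOn_inv_metric (i j : Fin 4) :
    ContDiffOn ℝ ∞ (fun x => (((g x)⁻¹ i j : ℝ) : ℂ)) U := by
  have he := hN.tetrad_smooth.e
  have h : ContDiffOn ℝ ∞ (fun x => ∑ a, ∑ b, eta a b * t.e a x i * t.e b x j) U :=
    ContDiffOn.sum fun a _ => ContDiffOn.sum fun b _ =>
      (contDiffOn_const.mul (he a i)).mul (he b j)
  exact h.congr fun x hx => hN.inv_metric_apply hx i j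

theorem contDiffOn_christoffel (hU : IsOpen U) (i j k : Fin 4) :
    ContDiffOn ℝ ∞ (fun x => (christoffel g i j k x : ℂ)) U := by
  have hd (j k l) := contDiffOn_fderiv_apply (hN.metric_smooth j k) hU (Pi.single l 1)
  have h : ContDiffOn ℝ ∞ (fun x => (1 / 2 : ℂ) * ∑ l, (((g x)⁻¹ i l : ℝ) : ℂ) *
      ((fderiv ℝ (fun y => g y l k) x (Pi.single j 1)
        + fderiv ℝ (fun y => g y l j) x (Pi.single k 1)
        - fderiv ℝ (fun y => g y j k) x (Pi.single l 1) : ℝ) : ℂ)) U :=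
    contDiffOn_const.mul (ContDiffOn.sum fun l _ => (hN.contDiffOn_inv_metric i l).mul
      (contDiffOn_ofReal (((hd _ _ _).add (hd _ _ _)).sub (hd _ _ _))))
  refine h.congr fun x _ => ?_
  simp only [christoffel]
  push_cast
  rfl

theorem contDiffOn_covDeriv (hU : IsOpen U) (a b i : Fin 4) :
    ContDiffOn ℝ ∞ (fun x => covDeriv g (t.e a) (t.e b) x i) U := by
  have he := hN.tetrad_smooth.e
  exact (contDiffOn_dirDeriv (he a) (he b i) hU).add
    (ContDiffOn.sum fun j _ => ContDiffOn.sum fun k _ =>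
      ((hN.contDiffOn_christoffel hU i j k).mul (he a j)).mul (he b k))

theorem eventually_isSymm (hU : IsOpen U) (hx : x ∈ U) : ∀ᶠ y in 𝓝 x, (g y).IsSymm :=
  eventually_of_mem (hU.mem_nhds hx) hN.metric_symm

theorem metricInner_covDeriv_antisymm (hU : IsOpen U) (hx : x ∈ U) (a b c : Fin 4) :
    metricInner g (t.e a) (covDeriv g (t.e c) (t.e b)) x
      = -metricInner g (t.e b) (covDeriv g (t.e c) (t.e a)) x := by
  have he (a i) := differentiableAt_of_contDiffOn (hN.tetrad_smooth.e a i) hU hx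
  have hg (i j) := differentiableAt_of_contDiffOn (hN.metric_smooth i j) hU hx
  have h := dirDeriv_metricInner_eq_covDeriv hg (hN.eventually_isSymm hU hx)
    (hN.isUnit_det_metric hx) (he a) (he b) (t.e c)
  rw [dirDeriv_congr_of_isOpen hU hx (g := fun _ => eta a b)
    (fun y hy => hN.inner_eq y hy a b), dirDeriv_const,
    metricInner_comm (hN.metric_symm x hx) _ (t.e b)] at h
  exact eq_neg_of_add_eq_zero_right h.symm

theorem isAdmissibleOn_ofMetric (hU : IsOpen U) {Rm : Fin 4 → Fin 4 → Fin 4 → Fin 4 → Scalar}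
    (hR : IsCurvatureFieldOn U Rm) : (Fields.ofMetric g t Rm).IsAdmissibleOn U where
  tetrad_smooth := hN.tetrad_smooth
  conn_smooth a b c := by
    change ContDiffOn ℝ ∞ (fun x => ∑ i, ∑ j,
      (g x i j : ℂ) * t.e a x i * covDeriv g (t.e c) (t.e b) x j) U
    exact ContDiffOn.sum fun i _ => ContDiffOn.sum fun j _ =>
      ((contDiffOn_ofReal (hN.metric_smooth i j)).mul (hN.tetrad_smooth.e a i)).mul
        (hN.contDiffOn_covDeriv hU c b j)
  conn_antisymm x hx a b c := hN.metricInner_covDeriv_antisymm hU hx a b c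
  conn_real x _ a b c := by
    simp only [Fields.ofMetric, star_metricInner, star_covDeriv, Fields.star_e]
  curv := hR

theorem commutatorsAt_ofMetric (hU : IsOpen U) (hx : x ∈ U)
    (Rm : Fin 4 → Fin 4 → Fin 4 → Fin 4 → Scalar) : (Fields.ofMetric g t Rm).CommutatorsAt x := by
  intro a b i
  have h := covDeriv_sub_covDeriv (hN.eventually_isSymm hU hx) (t.e a) (t.e b) i
  have ha := hN.sum_eta_mul_metricInner hx (covDeriv g (t.e a) (t.e b)) i
  have hb := hN.sum_eta_mul_metricInner hx (covDeriv g (t.e b) (t.e a)) i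
  simp only [Fields.comm, sub_mul, Finset.sum_sub_distrib]
  exact h.symm.trans (by rw [← ha, ← hb]; rfl)

end IsNullTetradOn

/-! ### The Bianchi identity for the curvature of the connection -/

namespace Fields

variable {F : Fields} {U : Set Coord} {x : Coord}

/-- The components of the exterior derivative of the two-form `(1/2) Ω_{ab} e^a ∧ e^b`, computed
with the commutation coefficients `γ^c_{ab}` of the connection. -/
def extDerivTwo (F : Fields) (Ω : Fin 4 → Fin 4 → Scalar) (c f h : Fin 4) : Scalar := fun x =>
  (F.d h (Ω c f) x - ∑ i, F.comm i h c x * Ω i f x)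
    + (F.d c (Ω f h) x - ∑ i, F.comm i c f x * Ω i h x)
    + (F.d f (Ω h c) x - ∑ i, F.comm i f h x * Ω i c x)

/-- The components of the exterior product of two one-forms. -/
def wedge (θ φ : Fin 4 → Scalar) (c f : Fin 4) : Scalar :=
  fun x => θ c x * φ f x - θ f x * φ c x

/-- Tetrad components `T_{abcf;h}` of the covariant derivative of a tensor field. -/
def cov4 (F : Fields) (T : Fin 4 → Fin 4 → Fin 4 → Fin 4 → Scalar) (a b c f h : Fin 4) : Scalar :=
  fun x => F.d h (T a b c f) x
    - ∑ i, (F.Γup i a h x * T i b c f x + F.Γup i b h x * T a i c f x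
        + F.Γup i c h x * T a b i f x + F.Γup i f h x * T a b c i x)

/-- The Bianchi identity `T_{ab[cf;h]} = 0` for a tensor field; `BianchiAt` is the case of the
candidate Riemann tensor. -/
def SatisfiesBianchiAt (F : Fields) (T : Fin 4 → Fin 4 → Fin 4 → Fin 4 → Scalar) (x : Coord) :
    Prop :=
  ∀ a b c f h, F.cov4 T a b c f h x + F.cov4 T a b f h c x + F.cov4 T a b h c f x = 0

theorem cartan_eq_extDeriv_add_wedge (F : Fields) (a b c f : Fin 4) :
    F.cartan a b c f
      = fun y => F.extDeriv (F.Γ a b) c f y + ∑ i, wedge (F.Γ a i) (F.Γup i b) c f y := by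
  funext y
  simp only [cartan_eq_extDeriv, wedge, mul_comm]

theorem extDerivTwo_wedge {θ φ : Fin 4 → Scalar} (hθ : ∀ a, DifferentiableAt ℝ (θ a) x)
    (hφ : ∀ a, DifferentiableAt ℝ (φ a) x) (c f h : Fin 4) :
    F.extDerivTwo (wedge θ φ) c f h x
      = (F.extDeriv θ c f x * φ h x + F.extDeriv θ f h x * φ c x + F.extDeriv θ h c x * φ f x)
      - (θ h x * F.extDeriv φ c f x + θ c x * F.extDeriv φ f h x
        + θ f x * F.extDeriv φ h c x) := by
  have hd (i c f : Fin 4) : F.d i (wedge θ φ c f) x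
      = (F.d i (θ c) x * φ f x + θ c x * F.d i (φ f) x)
      - (F.d i (θ f) x * φ c x + θ f x * F.d i (φ c) x) := by
    unfold d wedge
    rw [dirDeriv_sub ((hθ c).fun_mul (hφ f)) ((hθ f).fun_mul (hφ c)),
      dirDeriv_mul (hθ c) (hφ f), dirDeriv_mul (hθ f) (hφ c)]
  simp only [extDerivTwo, hd, extDeriv, wedge, Fin.sum_univ_four]
  ring

theorem cov4_add_cov4_add_cov4 {T : Fin 4 → Fin 4 → Fin 4 → Fin 4 → Scalar}
    (hT : ∀ a b c f, T a b c f x = -T a b f c x) (a b c f h : Fin 4) :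
    F.cov4 T a b c f h x + F.cov4 T a b f h c x + F.cov4 T a b h c f x
      = F.extDerivTwo (T a b) c f h x
      - ∑ i, ((F.Γup i a h x * T i b c f x + F.Γup i a c x * T i b f h x
          + F.Γup i a f x * T i b h c x)
        + (F.Γup i b h x * T a i c f x + F.Γup i b c x * T a i f h x
          + F.Γup i b f x * T a i h c x)) := by
  -- The terms in which `Γ` acts on the form indices combine into commutation coefficients.
  have hswap (c f h : Fin 4) :
      ∑ i, F.Γup i f h x * T a b c i x = -∑ i, F.Γup i f h x * T a b i c x := by
    simp only [hT a b c, mul_neg, Finset.sum_neg_distrib]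
  simp only [cov4, extDerivTwo, comm, Finset.sum_add_distrib, sub_mul, Finset.sum_sub_distrib,
    hswap]
  ring

namespace IsAdmissibleOn

variable (hF : F.IsAdmissibleOn U)
include hF

theorem contDiffOn_d (hU : IsOpen U) {f : Scalar} (hf : ContDiffOn ℝ ∞ f U) (a : Fin 4) :
    ContDiffOn ℝ ∞ (F.d a f) U :=
  contDiffOn_dirDeriv (hF.tetrad_smooth.e a) hf hU

theorem contDiffOn_Γup (a b c : Fin 4) : ContDiffOn ℝ ∞ (F.Γup a b c) U :=
  ContDiffOn.sum fun h _ => contDiffOn_const.mul (hF.conn_smooth h b c)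

theorem contDiffOn_comm (a b c : Fin 4) : ContDiffOn ℝ ∞ (F.comm a b c) U :=
  (hF.contDiffOn_Γup a c b).sub (hF.contDiffOn_Γup a b c)

theorem contDiffOn_extDeriv (hU : IsOpen U) {θ : Fin 4 → Scalar}
    (hθ : ∀ a, ContDiffOn ℝ ∞ (θ a) U) (c f : Fin 4) : ContDiffOn ℝ ∞ (F.extDeriv θ c f) U :=
  ((hF.contDiffOn_d hU (hθ f) c).sub (hF.contDiffOn_d hU (hθ c) f)).sub
    (ContDiffOn.sum fun h _ => (hF.contDiffOn_comm h c f).mul (hθ h))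

theorem contDiffOn_wedge_conn (a b i c f : Fin 4) :
    ContDiffOn ℝ ∞ (wedge (F.Γ a i) (F.Γup i b) c f) U :=
  ((hF.conn_smooth a i c).mul (hF.contDiffOn_Γup i b f)).sub
    ((hF.conn_smooth a i f).mul (hF.contDiffOn_Γup i b c))

theorem contDiffOn_cartan (hU : IsOpen U) (a b c f : Fin 4) :
    ContDiffOn ℝ ∞ (F.cartan a b c f) U := by
  rw [cartan_eq_extDeriv_add_wedge]
  exact (hF.contDiffOn_extDeriv hU (hF.conn_smooth a b) c f).add
    (ContDiffOn.sum fun i _ => hF.contDiffOn_wedge_conn a b i c f)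

theorem d_d_sub_d_d (hU : IsOpen U) (hx : x ∈ U) (hc : F.CommutatorsAt x) {f : Scalar}
    (hf : ContDiffOn ℝ ∞ f U) (a b : Fin 4) :
    F.d a (F.d b f) x - F.d b (F.d a f) x = ∑ c, F.comm c a b x * F.d c f x := by
  have he (a i) := differentiableAt_of_contDiffOn (hF.tetrad_smooth.e a i) hU hx
  have hf2 : ContDiffAt ℝ 2 f x := (hf.contDiffAt (hU.mem_nhds hx)).of_le (by norm_cast)
  calc F.d a (F.d b f) x - F.d b (F.d a f) x
      = ∑ i, (∑ c, F.comm c a b x * F.t.e c x i) * fderiv ℝ f x (Pi.single i 1) := by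
        simp only [← hc a b]
        exact dirDeriv_dirDeriv_sub (he a) (he b) hf2
    _ = ∑ c, F.comm c a b x * F.d c f x := by
        simp only [d, dirDeriv, Finset.mul_sum, Finset.sum_mul, mul_assoc]
        exact Finset.sum_comm

theorem d_extDeriv (hU : IsOpen U) (hx : x ∈ U) {θ : Fin 4 → Scalar}
    (hθ : ∀ a, ContDiffOn ℝ ∞ (θ a) U) (h c f : Fin 4) :
    F.d h (F.extDeriv θ c f) x = F.d h (F.d c (θ f)) x - F.d h (F.d f (θ c)) x
      - ∑ i, (F.d h (F.comm i c f) x * θ i x + F.comm i c f x * F.d h (θ i) x) := by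
  have hdθ (a i) := differentiableAt_of_contDiffOn (hF.contDiffOn_d hU (hθ i) a) hU hx
  have hθ' (i) := differentiableAt_of_contDiffOn (hθ i) hU hx
  have hcomm (i) := differentiableAt_of_contDiffOn (hF.contDiffOn_comm i c f) hU hx
  have hterm (i) := (hcomm i).fun_mul (hθ' i)
  have hdmul (i) : F.d h (F.comm i c f) x * θ i x + F.comm i c f x * F.d h (θ i) x
      = F.d h (fun y => F.comm i c f y * θ i y) x := (dirDeriv_mul (hcomm i) (hθ' i)).symm
  simp only [hdmul]
  unfold extDeriv
  rw [d, dirDeriv_sub ((hdθ c f).fun_sub (hdθ f c)) (DifferentiableAt.fun_sum fun i _ => hterm i),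
    dirDeriv_sub (hdθ c f) (hdθ f c), dirDeriv_sum fun i _ => hterm i]
  rfl

theorem extDerivTwo_extDeriv (hU : IsOpen U) (hx : x ∈ U) (hc : F.CommutatorsAt x)
    (hJ : F.JacobiAt x) {θ : Fin 4 → Scalar} (hθ : ∀ a, ContDiffOn ℝ ∞ (θ a) U) (c f h : Fin 4) :
    F.extDerivTwo (F.extDeriv θ) c f h x = 0 := by
  have hcomm (a b : Fin 4) {g : Scalar} (hg : ContDiffOn ℝ ∞ g U) :
      F.d a (F.d b g) x = F.d b (F.d a g) x + ∑ i, F.comm i a b x * F.d i g x := by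
    rw [← hF.d_d_sub_d_d hU hx hc hg, add_sub_cancel]
  have hjacobi : ∑ i, ((F.d h (F.comm i c f) x - ∑ j, F.comm i j h x * F.comm j c f x)
      + (F.d c (F.comm i f h) x - ∑ j, F.comm i j c x * F.comm j f h x)
      + (F.d f (F.comm i h c) x - ∑ j, F.comm i j f x * F.comm j h c x)) * θ i x = 0 :=
    Finset.sum_eq_zero fun i _ => by rw [hJ h c f i, zero_mul]
  simp only [extDerivTwo, hF.d_extDeriv hU hx hθ, hcomm h c (hθ f), hcomm c f (hθ h),
    hcomm f h (hθ c), extDeriv]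
  simp only [Fin.sum_univ_four] at hjacobi ⊢
  linear_combination -hjacobi

theorem extDerivTwo_cartan (hU : IsOpen U) (hx : x ∈ U) (hc : F.CommutatorsAt x)
    (hJ : F.JacobiAt x) (a b c f h : Fin 4) :
    F.extDerivTwo (F.cartan a b) c f h x
      = ∑ i, F.extDerivTwo (wedge (F.Γ a i) (F.Γup i b)) c f h x := by
  have hext (c f) :=
    differentiableAt_of_contDiffOn (hF.contDiffOn_extDeriv hU (hF.conn_smooth a b) c f) hU hx
  have hwedge (c f i) :=
    differentiableAt_of_contDiffOn (hF.contDiffOn_wedge_conn a b i c f) hU hx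
  have hd (h c f) : F.d h (F.cartan a b c f) x
      = F.d h (F.extDeriv (F.Γ a b) c f) x + ∑ i, F.d h (wedge (F.Γ a i) (F.Γup i b) c f) x := by
    rw [cartan_eq_extDeriv_add_wedge]
    unfold d
    rw [dirDeriv_add (hext c f) (DifferentiableAt.fun_sum fun i _ => hwedge c f i),
      dirDeriv_sum fun i _ => hwedge c f i]
  have hclosed := hF.extDerivTwo_extDeriv hU hx hc hJ (hF.conn_smooth a b) c f h
  simp only [extDerivTwo, hd]
  simp only [extDerivTwo, cartan_eq_extDeriv_add_wedge, Fin.sum_univ_four] at hclosed ⊢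
  linear_combination hclosed

theorem satisfiesBianchiAt_cartan (hU : IsOpen U) (hx : x ∈ U) (hc : F.CommutatorsAt x)
    (hJ : F.JacobiAt x) : F.SatisfiesBianchiAt F.cartan x := by
  intro a b c f h
  have hΓ (a b) := hF.conn_differentiableAt hU hx a b
  have hΓup (a b c) := differentiableAt_of_contDiffOn (hF.contDiffOn_Γup a b c) hU hx
  have hext (a b c f : Fin 4) : F.extDeriv (F.Γ a b) c f x = F.cartan a b c f x
      - ∑ i, (F.Γup i b f x * F.Γ a i c x - F.Γup i b c x * F.Γ a i f x) := by
    rw [cartan_eq_extDeriv, add_sub_cancel_right]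
  have hextup (a b c f : Fin 4) : F.extDeriv (F.Γup a b) c f x
      = ∑ i, eta a i * F.cartan i b c f x
      - ∑ i, (F.Γup i b f x * F.Γup a i c x - F.Γup i b c x * F.Γup a i f x) := by
    simp only [eta_sum_cartan, extDeriv, Finset.sum_sub_distrib]
    ring
  rw [cov4_add_cov4_add_cov4 (F.cartan_antisymm_right · · · · x),
    hF.extDerivTwo_cartan hU hx hc hJ]
  simp only [extDerivTwo_wedge (hΓ a _) (hΓup _ b), hext, hextup, eta_sum]
  have hanti (i c : Fin 4) := hF.conn_antisymm x hx a i c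
  simp only [Fin.sum_univ_four, Γup_zero, Γup_one, Γup_two, Γup_three, hanti, Matrix.cons_val]
  ring

end IsAdmissibleOn

/-! ### Fields annihilated by `k` -/

theorem SatisfiesBianchiAt.sub {T S : Fin 4 → Fin 4 → Fin 4 → Fin 4 → Scalar}
    (hT : F.SatisfiesBianchiAt T x) (hS : F.SatisfiesBianchiAt S x)
    (hTd : ∀ a b c f, DifferentiableAt ℝ (T a b c f) x)
    (hSd : ∀ a b c f, DifferentiableAt ℝ (S a b c f) x) :
    F.SatisfiesBianchiAt (fun a b c f y => T a b c f y - S a b c f y) x := by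
  have hsub (a b c f h : Fin 4) : F.cov4 (fun a b c f y => T a b c f y - S a b c f y) a b c f h x
      = F.cov4 T a b c f h x - F.cov4 S a b c f h x := by
    simp only [cov4, d, dirDeriv_sub (hTd a b c f) (hSd a b c f), Fin.sum_univ_four]
    ring
  intro a b c f h
  simp only [hsub]
  linear_combination hT a b c f h - hS a b c f h

section Annihilator

variable {S : Fin 4 → Fin 4 → Fin 4 → Fin 4 → Scalar} {X : Fin 4 → Scalar}

theorem sum_cov1_mul (hU : IsOpen U) (hx : x ∈ U)
    (hS : ∀ a b c f, DifferentiableAt ℝ (S a b c f) x) (hX : ∀ a, DifferentiableAt ℝ (X a) x)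
    (hXS : ∀ y ∈ U, ∀ b c f, ∑ a, X a y * S a b c f y = 0) (b c f h : Fin 4) :
    ∑ a, F.cov1 X a h x * S a b c f x = -∑ a, X a x * F.cov4 S a b c f h x := by
  have hLeibniz : ∑ a, (F.d h (X a) x * S a b c f x + X a x * F.d h (S a b c f) x) = 0 := by
    have hd := dirDeriv_congr_of_isOpen (v := F.t.e h) hU hx (g := fun _ => 0)
      (fun y hy => hXS y hy b c f)
    rw [dirDeriv_const, dirDeriv_sum fun a _ => (hX a).fun_mul (hS a b c f)] at hd
    rw [← hd]
    exact Finset.sum_congr rfl fun a _ => (dirDeriv_mul (hX a) (hS a b c f)).symm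
  have hconn : ∑ i, (F.Γup i b h x * ∑ a, X a x * S a i c f x
      + F.Γup i c h x * ∑ a, X a x * S a b i f x
      + F.Γup i f h x * ∑ a, X a x * S a b c i x) = 0 := by
    simp only [hXS x hx, mul_zero, add_zero, Finset.sum_const_zero]
  simp only [cov1, cov4, Fin.sum_univ_four] at hLeibniz hconn ⊢
  linear_combination hLeibniz - hconn

theorem sum_cov1_three_mul_eq_zero (hU : IsOpen U)
    (hS : ∀ x ∈ U, ∀ a b c f, DifferentiableAt ℝ (S a b c f) x)
    (hanti : ∀ x ∈ U, ∀ a b c f, S a b c f x = -S a b f c x)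
    (hB : ∀ x ∈ U, F.SatisfiesBianchiAt S x) (hk : ∀ x ∈ U, ∀ a b c, S a b c 3 x = 0)
    (hX : ∀ x ∈ U, ∀ a, DifferentiableAt ℝ (X a) x)
    (hXS : ∀ x ∈ U, ∀ b c f, ∑ a, X a x * S a b c f x = 0) :
    ∀ x ∈ U, ∀ b c f, ∑ a, F.cov1 X a 3 x * S a b c f x = 0 := by
  intro x hx b c f
  have hk' (y) (hy : y ∈ U) (a b c) : S a b 3 c y = 0 := by rw [hanti y hy, hk y hy, neg_zero]
  have hd (a b c h) : F.d h (S a b c 3) x = 0 :=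
    (dirDeriv_congr_of_isOpen hU hx fun y hy => hk y hy a b c).trans (dirDeriv_const _ 0 _)
  have hd' (a b c h) : F.d h (S a b 3 c) x = 0 :=
    (dirDeriv_congr_of_isOpen hU hx fun y hy => hk' y hy a b c).trans (dirDeriv_const _ 0 _)
  have hcov (a) : F.cov4 S a b c f 3 x
      = ∑ i, (F.Γup i 3 c x * S a b f i x + F.Γup i 3 f x * S a b i c x) := by
    have hBianchi := hB x hx a b c f 3
    simp only [cov4, hd, hd', hk x hx, hk' x hx, Fin.sum_univ_four] at hBianchi ⊢
    linear_combination hBianchi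
  calc ∑ a, F.cov1 X a 3 x * S a b c f x
      = -∑ i, (F.Γup i 3 c x * ∑ a, X a x * S a b f i x
          + F.Γup i 3 f x * ∑ a, X a x * S a b i c x) := by
        rw [sum_cov1_mul hU hx (hS x hx) (hX x hx) hXS]
        simp only [hcov, Fin.sum_univ_four]
        ring
    _ = 0 := by simp only [hXS x hx, mul_zero, add_zero, Finset.sum_const_zero, neg_zero]

end Annihilator

namespace IsAdmissibleOn

variable (hF : F.IsAdmissibleOn U)
include hF

theorem differentiableAt_defect (hU : IsOpen U) (hx : x ∈ U) (a b c f : Fin 4) :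
    DifferentiableAt ℝ (F.defect a b c f) x :=
  differentiableAt_of_contDiffOn
    ((hF.curv.smooth a b c f).sub (hF.contDiffOn_cartan hU a b c f)) hU hx

theorem satisfiesBianchiAt_defect (hU : IsOpen U) (hx : x ∈ U) (hc : F.CommutatorsAt x)
    (hJ : F.JacobiAt x) (hB : F.BianchiAt x) : F.SatisfiesBianchiAt F.defect x :=
  SatisfiesBianchiAt.sub hB (hF.satisfiesBianchiAt_cartan hU hx hc hJ)
    (fun a b c f => differentiableAt_of_contDiffOn (hF.curv.smooth a b c f) hU hx)
    (fun a b c f => differentiableAt_of_contDiffOn (hF.contDiffOn_cartan hU a b c f) hU hx)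

theorem cov1_Γup_three_three (hU : IsOpen U) (hx : x ∈ U) :
    F.cov1 (fun a => F.Γup a 3 3) 2 3 x = 2 * F.Γ 0 3 3 x * F.Γ 1 3 3 x := by
  have hd : F.d 3 (fun y => -F.Γ 3 3 3 y) x = 0 :=
    (dirDeriv_congr_of_isOpen hU hx fun y hy => by
      rw [hF.conn_self hy, neg_zero]).trans (dirDeriv_const _ 0 _)
  simp only [cov1, hd, Fin.sum_univ_four, Γup_zero, Γup_one, Γup_two, Γup_three,
    hF.conn_self hx, hF.conn_antisymm x hx 3]
  ring

theorem conn_ne_zero_of_kappa_ne_zero (hx : x ∈ U) (hκ : F.κ x ≠ 0) :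
    F.Γ 0 3 3 x ≠ 0 ∧ F.Γ 1 3 3 x ≠ 0 := by
  have h0 : F.Γ 0 3 3 x ≠ 0 := neg_ne_zero.mp hκ
  refine ⟨h0, fun h1 => h0 ?_⟩
  have hreal := hF.conn_real x hx 1 3 3
  rw [h1, star_zero] at hreal
  exact hreal.symm

theorem cartanAt_of_kappa_ne_zero (hU : IsOpen U) (hc : ∀ x ∈ U, F.CommutatorsAt x)
    (hJ : ∀ x ∈ U, F.JacobiAt x) (hR : ∀ x ∈ U, F.RicciAt x) (hB : ∀ x ∈ U, F.BianchiAt x)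
    (hx : x ∈ U) (hκ : F.κ x ≠ 0) : F.CartanAt x := by
  have hΩ (y) (hy : y ∈ U) := hF.isRealBiform_defect hU hy
  have hk (y) (hy : y ∈ U) (b c f) : F.defect 3 b c f y = 0 := by
    rw [(hΩ y hy).antisymm_left, ricciAt_iff_defect.mp (hR y hy), neg_zero]
  have hlast (y) (hy : y ∈ U) : ∀ a b c, F.defect a b c 3 y = 0 :=
    (hΩ y hy).last_eq_zero ((hF.jacobiAt_iff_defect hU hy).mp (hJ y hy))
      (ricciAt_iff_defect.mp (hR y hy))
  have hcov {X : Fin 4 → Scalar} := sum_cov1_three_mul_eq_zero (F := F) (X := X) hU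
    (fun y hy => hF.differentiableAt_defect hU hy) (fun y hy => (hΩ y hy).antisymm_right)
    (fun y hy => hF.satisfiesBianchiAt_defect hU hy (hc y hy) (hJ y hy) (hB y hy)) hlast
  have hkk : ∀ y ∈ U, ∀ b c f, ∑ a, F.Γup a 3 3 y * F.defect a b c f y = 0 := by
    simpa only [cov1_kComp] using hcov (X := kComp) (fun _ _ _ => differentiableAt_const _)
      (fun y hy b c f => by simp [kComp, hk y hy])
  have hkkk := hcov (X := fun a => F.Γup a 3 3)
    (fun y hy a => differentiableAt_of_contDiffOn (hF.contDiffOn_Γup a 3 3) hU hy) hkk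
  obtain ⟨hκ0, hκ1⟩ := hF.conn_ne_zero_of_kappa_ne_zero hx hκ
  rw [cartanAt_iff_defect]
  intro a b c f
  refine eq_zero_of_antisymm_of_annihilated ((hΩ x hx).antisymm_left · · c f) (hk x hx · c f)
    (hkk x hx · c f) ?_ ?_ (hkkk x hx · c f) ?_ a b
  · simp only [Γup_two, hF.conn_self hx, neg_zero]
  · rwa [Γup_one]
  · rw [hF.cov1_Γup_three_three hU hx]
    exact mul_ne_zero (mul_ne_zero two_ne_zero hκ0) hκ1

end IsAdmissibleOn

end Fields

end NewmanPenrose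

end

open NewmanPenrose in
theorem theorem3 :
    -- The Newman-Penrose equations are the second Cartan equations; their Jacobi and Ricci parts
    -- are the Jacobi equations and the Ricci equations for `k`, and what is left of them after
    -- these two parts are the equations NP10, NP13, Re NP12, Re NP14.
    (∀ (U : Set Coord) (F : Fields), IsOpen U → F.IsAdmissibleOn U → ∀ x ∈ U,
      (F.CartanAt x ↔ F.AllNPAt x) ∧
      (F.JacobiAt x ↔ F.JacobiNPAt x) ∧
      (F.RicciAt x ↔ F.RicciNPAt x) ∧
      (F.AllNPAt x ↔ F.JacobiNPAt x ∧ F.RicciNPAt x ∧ F.FieldNPAt x)) ∧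
    -- If `κ ≠ 0`, each solution of the remaining Newman-Penrose equations and the Bianchi equations
    -- satisfies NP10, NP13, Re NP12, Re NP14.
    (∀ (U : Set Coord) (g : Coord → Matrix (Fin 4) (Fin 4) ℝ) (t : Tetrad)
      (Rm : Fin 4 → Fin 4 → Fin 4 → Fin 4 → Scalar), IsOpen U →
      IsNullTetradOn U g t → IsCurvatureFieldOn U Rm →
      (∀ x ∈ U, (Fields.ofMetric g t Rm).κ x ≠ 0) →
      (∀ x ∈ U, (Fields.ofMetric g t Rm).JacobiNPAt x) →
      (∀ x ∈ U, (Fields.ofMetric g t Rm).RicciNPAt x) →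
      (∀ x ∈ U, (Fields.ofMetric g t Rm).BianchiAt x) →
      ∀ x ∈ U, (Fields.ofMetric g t Rm).FieldNPAt x) ∧
    -- They are not algebraic consequences of these equations: at a point where the commutator
    -- relations, the remaining Newman-Penrose equations and the Bianchi equations hold and
    -- `κ ≠ 0`, the left-hand sides can have arbitrary values. So they arise by differentiation.
    (∀ (a b : ℂ) (c d : ℝ), ∃ (F : Fields) (x : Coord),
      F.IsAdmissibleOn Set.univ ∧ LinearIndependent ℂ (fun i => F.t.e i x) ∧ F.κ x ≠ 0 ∧
      F.CommutatorsAt x ∧ F.JacobiNPAt x ∧ F.RicciNPAt x ∧ F.BianchiAt x ∧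
      F.NP10 x = a ∧ F.NP13 x = b ∧
      (F.NP12 + star F.NP12) x = c ∧ (F.NP14 + star F.NP14) x = d) := by
  refine ⟨fun U F hU hF x hx => ⟨hF.cartanAt_iff_allNPAt hU hx, hF.jacobiAt_iff_jacobiNPAt hU hx,
    hF.ricciAt_iff_ricciNPAt hU hx, Fields.allNPAt_iff⟩, ?_, exists_isAdmissibleOn_fieldNP⟩
  intro U g t Rm hU hN hRm hκ hJ hR hB x hx
  have hF := hN.isAdmissibleOn_ofMetric hU hRm
  have hC := hF.cartanAt_of_kappa_ne_zero hU (fun y hy => hN.commutatorsAt_ofMetric hU hy Rm)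
    (fun y hy => (hF.jacobiAt_iff_jacobiNPAt hU hy).mpr (hJ y hy))
    (fun y hy => (hF.ricciAt_iff_ricciNPAt hU hy).mpr (hR y hy)) hB hx (hκ x hx)
  exact (Fields.allNPAt_iff.mp ((hF.cartanAt_iff_allNPAt hU hx).mp hC)).2.2
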